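/- Let $Y_1,\dots,Y_d$ be a basis of $\mathbb R^d$, let $\mathcal R$ be the lattice it generates, and let $\mathcal V\subset\mathbb R^d$ be a unit cell, i.e. a (measurable) set whose $\mathcal R$-translates tile $\mathbb R^d$ up to null sets. Write $\langle f\rangle=\frac1{|\mathcal V|}\int_{\mathcal V}f\,dx$ and $s:e=\sum_{i,j}s_{ij}e_{ij}$. Let $L^2_{per}$ be the space of $\mathcal R$-periodic functions in $L^2_{loc}(\mathbb R^d)$ and $H^1_{per}$ the space of those $w\in L^2_{per}$ whose weak partial derivatives lie in $L^2_{per}$. Let $L_0$ be a constant fourth-order tensor with minor and major symmetries that is positive definite on symmetric second-order tensors, and let $x\mapsto L(x)$ be an $\mathcal R$-periodic, measurable, essentially bounded fourth-order tensor field with minor and major symmetries. Let $H_e$ be the space of symmetric second-order tensor fields with components in $L^2_{per}$, with the energetic scalar product $(\eta,\tilde\eta)=\langle L_0\eta:\tilde\eta\rangle$ and the norm $\|\cdot\|$ it induces, and let $H_s$ be the same space of fields, seen as stress fields. Let $E_0\subset H_e$ be the subspace of fields $\tfrac12(\nabla w+\nabla w^{\top})$ with $w\in (H^1_{per})^d$.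 Let $S\subset H_s$ be the sum of the subspace of uniform fields and the subspace of mean-free fields $s$ such that $\operatorname{div}s=0$ on $\mathbb R^d$ in the sense of distributions (that is, $\operatorname{div}s=0$ in $\mathcal V$ with $s\cdot n$ anti-periodic on $\partial\mathcal V$). For a functional $F:E_0\to\mathbb R$, an element $g\in E_0$ is called a gradient of $F$ at $e^*\in E_0$ if $$(g,\tilde e)=\lim_{t\to0}\frac{F(e^*+t\tilde e)-F(e^*)}{t}\qquad\text{for all }\tilde e\in E_0 .$$ Then for every $\tau\in H_s$ there is a unique $e\in E_0$ with $L_0e-\tau\in S$; denote it by $\Gamma_0\tau$ (the strain Green's operator). Moreover, let $\bar\varepsilon$ be a uniform symmetric strain field, and for $e^*\in E_0$ let $$J(e^*)=\tfrac12\big\langle L(\bar\varepsilon+e^*):(\bar\varepsilon+e^*)\big\rangle .$$ Then, for every $e^*\in E_0$: 1. $J$ has exactly one gradient at $e^*$, namely $\nabla J(e^*)=\Gamma_0L(\bar\varepsilon+e^*)$. 2. The geometric functional $N(e^*):=\tfrac12\|\nabla J(e^*)\|^2$ equals $\tfrac12\|\Gamma_0L(\bar\varepsilon+e^*)\|^2$.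 3. $N$ has exactly one gradient at $e^*$, namely $\nabla N(e^*)=\Gamma_0L\,\Gamma_0L(\bar\varepsilon+e^*)\in E_0$. -/

import Mathlib

open MeasureTheory Filter Topology
open scoped ENNReal ContDiff

noncomputable section

namespace Homogenization

/-- Physical space `ℝ^d`. -/
abbrev Space (d : ℕ) := EuclideanSpace ℝ (Fin d)

/-- A unit cell `V` that fills `ℝ^d` by translation along the `d` independent vectors `Y`:
the translates of `V` by the lattice generated by `Y` cover `ℝ^d` and do not overlap,
up to null sets. -/
structure UnitCell (d : ℕ) where
  Y : Module.Basis (Fin d) ℝ (Space d)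
  V : Set (Space d)
  fills : IsAddFundamentalDomain (Submodule.span ℤ (Set.range Y)) V volume

/-- The lattice of periods `∑ n_j Y_j`, `n_j ∈ ℤ`. -/
abbrev UnitCell.lattice {d : ℕ} (C : UnitCell d) : Submodule ℤ (Space d) :=
  Submodule.span ℤ (Set.range C.Y)

/-- A (uniform) elastic stiffness tensor: a fourth-order tensor with minor and major symmetries
that is positive definite on symmetric second-order tensors. -/
structure Stiffness (d : ℕ) where
  c : Fin d → Fin d → Fin d → Fin d → ℝ
  minor_left : ∀ i j k l, c i j k l = c j i k l
  minor_right : ∀ i j k l, c i j k l = c i j l k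
  major : ∀ i j k l, c i j k l = c k l i j
  pos_def : ∀ a : Fin d → Fin d → ℝ, (∀ i j, a i j = a j i) → a ≠ 0 →
    0 < ∑ i, ∑ j, (∑ k, ∑ l, c i j k l * a k l) * a i j

/-- A periodic heterogeneous elasticity tensor field `x ↦ L(x)` with essentially bounded
(measurable) components and with minor and major symmetries. -/
structure ElasticityField {d : ℕ} (C : UnitCell d) where
  c : Fin d → Fin d → Fin d → Fin d → Space d → ℝ
  bounded : ∀ i j k l, MemLp (c i j k l) ∞ volume
  periodic : ∀ i j k l, ∀ Y ∈ C.lattice, ∀ᵐ x, c i j k l (x + Y) = c i j k l x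
  minor_left : ∀ i j k l, ∀ᵐ x, c i j k l x = c j i k l x
  minor_right : ∀ i j k l, ∀ᵐ x, c i j k l x = c i j l k x
  major : ∀ i j k l, ∀ᵐ x, c i j k l x = c k l i j x

variable {d : ℕ}

/-- `L²_per(V)`: (classes of) functions in `L²_loc(ℝ^d)` that are periodic. -/
def L2per (C : UnitCell d) : Submodule ℝ (Space d →ₘ[volume] ℝ) where
  carrier := {f | (∀ K : Set (Space d), IsCompact K → MemLp f 2 (volume.restrict K)) ∧
    ∀ Y ∈ C.lattice, ∀ᵐ x, f (x + Y) = f x}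
  zero_mem' := by
    refine ⟨fun K _ => ?_, fun Y _ => ?_⟩
    · refine (memLp_congr_ae (ae_restrict_of_ae AEEqFun.coeFn_zero)).2 MemLp.zero
    · have h0 := AEEqFun.coeFn_zero (μ := (volume : Measure (Space d))) (β := ℝ)
      filter_upwards [h0, (measurePreserving_add_right volume Y).quasiMeasurePreserving.ae h0]
        with x h1 h2
      rw [h1, h2]; rfl
  add_mem' := by
    rintro f g ⟨hf, hf'⟩ ⟨hg, hg'⟩
    refine ⟨fun K hK => ?_, fun Y hY => ?_⟩
    · exact (memLp_congr_ae (ae_restrict_of_ae (AEEqFun.coeFn_add f g))).2 ((hf K hK).add (hg K hK))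
    · have h0 := AEEqFun.coeFn_add f g
      filter_upwards [h0, (measurePreserving_add_right volume Y).quasiMeasurePreserving.ae h0,
        hf' Y hY, hg' Y hY] with x h1 h2 h3 h4
      rw [h1, h2, Pi.add_apply, Pi.add_apply, h3, h4]
  smul_mem' := by
    rintro r f ⟨hf, hf'⟩
    refine ⟨fun K hK => ?_, fun Y hY => ?_⟩
    · exact (memLp_congr_ae (ae_restrict_of_ae (AEEqFun.coeFn_smul r f))).2 ((hf K hK).const_smul r)
    · have h0 := AEEqFun.coeFn_smul r f
      filter_upwards [h0, (measurePreserving_add_right volume Y).quasiMeasurePreserving.ae h0,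
        hf' Y hY] with x h1 h2 h3
      rw [h1, h2, Pi.smul_apply, Pi.smul_apply, h3]

/-- Symmetric second-order tensor fields with components in `L²_per(V)`. -/
def TensorField (C : UnitCell d) : Submodule ℝ (Fin d → Fin d → (Space d →ₘ[volume] ℝ)) where
  carrier := {F | (∀ j k, F j k = F k j) ∧ ∀ j k, F j k ∈ L2per C}
  zero_mem' := ⟨fun _ _ => rfl, fun _ _ => (L2per C).zero_mem⟩
  add_mem' := fun {F G} hF hG =>
    ⟨fun j k => by simp only [Pi.add_apply, hF.1 j k, hG.1 j k],
      fun j k => (L2per C).add_mem (hF.2 j k) (hG.2 j k)⟩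
  smul_mem' := fun r F hF =>
    ⟨fun j k => by simp only [Pi.smul_apply, hF.1 j k],
      fun j k => (L2per C).smul_mem r (hF.2 j k)⟩

/-- The duality product `⟨τ, η⟩ = (1/|V|) ∫_V τ(x) : η(x) dx` (virtual work). -/
def pairing {C : UnitCell d} (τ η : TensorField C) : ℝ :=
  ⨍ x in C.V, ∑ i, ∑ j, τ.1 i j x * η.1 i j x

/-- The uniform stiffness acting on tensor fields: `(L₀ η)_{ij} = ∑_{kl} (L₀)_{ijkl} η_{kl}`. -/
def Stiffness.act {C : UnitCell d} (L₀ : Stiffness d) (η : TensorField C) : TensorField C :=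
  ⟨fun i j => ∑ k, ∑ l, L₀.c i j k l • η.1 k l,
    fun i j => by simp only [L₀.minor_left i j],
    fun i j => Submodule.sum_mem _ fun k _ => Submodule.sum_mem _ fun l _ =>
      Submodule.smul_mem _ _ (η.2.2 k l)⟩

/-! ### The energetic scalar product -/

lemma exists_periodic_rep {C : UnitCell d} {f : Space d →ₘ[volume] ℝ} (hf : f ∈ L2per C) :
    ∃ g : Space d → ℝ, f =ᵐ[volume] g ∧ ∀ (Y : C.lattice) (x), g (Y +ᵥ x) = g x := by
  have hc : Countable C.lattice := inferInstance
  set A : Set (Space d) := {x | ∀ Y : C.lattice, f (x + Y) = f x} with hA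
  have hAae : ∀ᵐ x, x ∈ A := ae_all_iff.2 fun Y => hf.2 Y Y.2
  have hsub : ∀ (Y : C.lattice) (x), x ∈ A → Y +ᵥ x ∈ A := by
    intro Y x hx Z
    have h1 := hx (Y + Z)
    have h2 := hx Y
    have e1 : (Y +ᵥ x : Space d) = x + Y := by
      rw [Submodule.vadd_def, vadd_eq_add, add_comm]
    rw [e1, h2, ← h1, Submodule.coe_add, add_assoc]
  refine ⟨A.indicator f, ?_, fun Y x => ?_⟩
  · filter_upwards [hAae] with x hx
    rw [Set.indicator_of_mem hx]
  · by_cases hx : x ∈ A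
    · rw [Set.indicator_of_mem hx, Set.indicator_of_mem (hsub Y x hx), Submodule.vadd_def,
        vadd_eq_add, add_comm, hx Y]
    · have : Y +ᵥ x ∉ A := fun h => hx (by simpa using hsub (-Y) _ h)
      rw [Set.indicator_of_notMem hx, Set.indicator_of_notMem this]

instance (C : UnitCell d) : VAddInvariantMeasure C.lattice (Space d) volume :=
  ⟨fun Y s _ => by
    have : (fun x : Space d => Y +ᵥ x) = fun x => (Y : Space d) + x := rfl
    rw [this, measure_preimage_add]⟩

lemma memLp_cell {C : UnitCell d} {f : Space d →ₘ[volume] ℝ} (hf : f ∈ L2per C) :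
    MemLp f 2 (volume.restrict C.V) := by
  obtain ⟨g, hfg, hg⟩ := exists_periodic_rep hf
  have hF := ZSpan.isAddFundamentalDomain C.Y (volume : Measure (Space d))
  have hc : Countable C.lattice := inferInstance
  have hK : IsCompact (closure (ZSpan.fundamentalDomain C.Y)) :=
    (ZSpan.fundamentalDomain_isBounded C.Y).isCompact_closure
  have h1 : MemLp g 2 (volume.restrict (ZSpan.fundamentalDomain C.Y)) :=
    (memLp_congr_ae (ae_restrict_of_ae hfg)).1
      ((hf.1 _ hK).mono_measure (Measure.restrict_mono subset_closure le_rfl))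
  refine (memLp_congr_ae (ae_restrict_of_ae hfg)).2 ?_
  have hgm : AEStronglyMeasurable g volume := f.aestronglyMeasurable.congr hfg
  rw [memLp_two_iff_integrable_sq hgm.restrict]
  rw [memLp_two_iff_integrable_sq hgm.restrict] at h1
  exact (C.fills.integrableOn_iff hF fun Y x => by rw [hg]).2 h1

lemma integrable_cell {C : UnitCell d} (τ η : TensorField C) :
    Integrable (fun x => ∑ i, ∑ j, τ.1 i j x * η.1 i j x) (volume.restrict C.V) :=
  integrable_finsetSum _ fun i _ => integrable_finsetSum _ fun j _ =>
    (memLp_cell (τ.2.2 i j)).integrable_mul (memLp_cell (η.2.2 i j))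

lemma volume_cell_ne_zero (C : UnitCell d) : volume.real C.V ≠ 0 := by
  have hF := ZSpan.isAddFundamentalDomain C.Y (volume : Measure (Space d))
  have hc : Countable C.lattice := inferInstance
  rw [measureReal_def, C.fills.measure_eq hF, ENNReal.toReal_ne_zero]
  exact ⟨ZSpan.measure_fundamentalDomain_ne_zero C.Y,
    (ZSpan.fundamentalDomain_isBounded C.Y).measure_lt_top.ne⟩

lemma act_apply_ae {C : UnitCell d} (L₀ : Stiffness d) (η : TensorField C) :
    ∀ᵐ x, ∀ i j, (L₀.act η).1 i j x = ∑ k, ∑ l, L₀.c i j k l * η.1 k l x := by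
  refine ae_all_iff.2 fun i => ae_all_iff.2 fun j => ?_
  have h1 : ∀ᵐ x, ∀ k l, (L₀.c i j k l • η.1 k l) x = L₀.c i j k l * η.1 k l x := by
    refine ae_all_iff.2 fun k => ae_all_iff.2 fun l => ?_
    filter_upwards [AEEqFun.coeFn_smul (L₀.c i j k l) (η.1 k l)] with x hx
    rw [hx]; rfl
  have h2 : ∀ᵐ x, ∀ k, (∑ l, L₀.c i j k l • η.1 k l : Space d →ₘ[volume] ℝ) x
      = ∑ l, (L₀.c i j k l • η.1 k l) x := by
    refine ae_all_iff.2 fun k => ?_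
    filter_upwards [AEEqFun.coeFn_finsetSum Finset.univ (fun l => L₀.c i j k l • η.1 k l)]
      with x hx
    simpa using hx
  have h3 : ∀ᵐ x, (∑ k, ∑ l, L₀.c i j k l • η.1 k l : Space d →ₘ[volume] ℝ) x
      = ∑ k, (∑ l, L₀.c i j k l • η.1 k l : Space d →ₘ[volume] ℝ) x := by
    filter_upwards [AEEqFun.coeFn_finsetSum Finset.univ
      (fun k => ∑ l, L₀.c i j k l • η.1 k l)] with x hx
    simpa using hx
  filter_upwards [h1, h2, h3] with x a b c
  refine c.trans (Finset.sum_congr rfl fun k _ => (b k).trans (Finset.sum_congr rfl fun l _ => a k l))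

lemma act_add {C : UnitCell d} (L₀ : Stiffness d) (η ζ : TensorField C) :
    L₀.act (η + ζ) = L₀.act η + L₀.act ζ := by
  refine Subtype.ext (funext fun i => funext fun j => ?_)
  simp only [Stiffness.act, Submodule.coe_add, Pi.add_apply, smul_add, Finset.sum_add_distrib]

lemma act_smul {C : UnitCell d} (L₀ : Stiffness d) (r : ℝ) (η : TensorField C) :
    L₀.act (r • η) = r • L₀.act η := by
  refine Subtype.ext (funext fun i => funext fun j => ?_)
  simp only [Stiffness.act, Submodule.coe_smul, Pi.smul_apply, Finset.smul_sum, smul_comm r]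

lemma pairing_add_left {C : UnitCell d} (τ σ η : TensorField C) :
    pairing (τ + σ) η = pairing τ η + pairing σ η := by
  simp only [pairing, setAverage_eq]
  rw [← smul_add, ← integral_add (integrable_cell τ η) (integrable_cell σ η)]
  refine congrArg _ ?_
  refine integral_congr_ae (ae_restrict_of_ae ?_)
  have h : ∀ᵐ x, ∀ i j, (τ + σ).1 i j x = τ.1 i j x + σ.1 i j x :=
    ae_all_iff.2 fun i => ae_all_iff.2 fun j => AEEqFun.coeFn_add (τ.1 i j) (σ.1 i j)
  filter_upwards [h] with x hx
  simp only [hx, add_mul, Finset.sum_add_distrib]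

lemma pairing_smul_left {C : UnitCell d} (r : ℝ) (τ η : TensorField C) :
    pairing (r • τ) η = r * pairing τ η := by
  simp only [pairing, setAverage_eq, smul_eq_mul]
  rw [mul_left_comm, ← integral_const_mul r]
  refine congrArg _ ?_
  refine integral_congr_ae (ae_restrict_of_ae ?_)
  have h : ∀ᵐ x, ∀ i j, (r • τ).1 i j x = r * τ.1 i j x :=
    ae_all_iff.2 fun i => ae_all_iff.2 fun j => AEEqFun.coeFn_smul r (τ.1 i j)
  filter_upwards [h] with x hx
  simp only [hx, mul_assoc, Finset.mul_sum]

lemma pairing_act_comm {C : UnitCell d} (L₀ : Stiffness d) (η ζ : TensorField C) :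
    pairing (L₀.act η) ζ = pairing (L₀.act ζ) η := by
  simp only [pairing, setAverage_eq]
  congr 1
  refine integral_congr_ae (ae_restrict_of_ae ?_)
  filter_upwards [act_apply_ae L₀ η, act_apply_ae L₀ ζ] with x h1 h2
  have key : ∀ a b : Fin d → Fin d → ℝ,
      ∑ i, ∑ j, (∑ k, ∑ l, L₀.c i j k l * a k l) * b i j
        = ∑ p : Fin d × Fin d, ∑ q : Fin d × Fin d, L₀.c p.1 p.2 q.1 q.2 * a q.1 q.2 * b p.1 p.2 := by
    intro a b
    simp only [Fintype.sum_prod_type, Finset.sum_mul]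
  simp only [h1, h2]
  rw [key (fun k l => η.1 k l x) (fun k l => ζ.1 k l x),
    key (fun k l => ζ.1 k l x) (fun k l => η.1 k l x), Finset.sum_comm]
  refine Finset.sum_congr rfl fun p _ => Finset.sum_congr rfl fun q _ => ?_
  rw [L₀.major q.1 q.2 p.1 p.2]; ring

lemma symm_ae {C : UnitCell d} (η : TensorField C) : ∀ᵐ x, ∀ i j, η.1 i j x = η.1 j i x :=
  Eventually.of_forall fun x i j => by rw [η.2.1 i j]

lemma energy_density_nonneg (L₀ : Stiffness d) (a : Fin d → Fin d → ℝ) (ha : ∀ i j, a i j = a j i) :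
    0 ≤ ∑ i, ∑ j, (∑ k, ∑ l, L₀.c i j k l * a k l) * a i j := by
  by_cases h : a = 0
  · simp [h]
  · exact (L₀.pos_def a ha h).le

lemma pairing_act_self_nonneg {C : UnitCell d} (L₀ : Stiffness d) (η : TensorField C) :
    0 ≤ pairing (L₀.act η) η := by
  simp only [pairing, setAverage_eq, smul_eq_mul]
  refine mul_nonneg (inv_nonneg.2 measureReal_nonneg) (integral_nonneg_of_ae (ae_restrict_of_ae ?_))
  filter_upwards [act_apply_ae L₀ η, symm_ae η] with x h1 h2
  simp only [h1, Pi.zero_apply]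
  exact energy_density_nonneg L₀ (fun i j => η.1 i j x) h2

lemma eq_zero_of_pairing_act_self {C : UnitCell d} (L₀ : Stiffness d) (η : TensorField C)
    (h : pairing (L₀.act η) η = 0) : η = 0 := by
  have hc : Countable C.lattice := inferInstance
  simp only [pairing, setAverage_eq, smul_eq_mul, mul_eq_zero, inv_eq_zero,
    volume_cell_ne_zero C, false_or] at h
  have hd : ∀ᵐ x ∂(volume.restrict C.V),
      (∀ i j, (L₀.act η).1 i j x = ∑ k, ∑ l, L₀.c i j k l * η.1 k l x) ∧
      ∀ i j, η.1 i j x = η.1 j i x :=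
    ae_restrict_of_ae ((act_apply_ae L₀ η).and (symm_ae η))
  rw [integral_eq_zero_iff_of_nonneg_ae ?_ (integrable_cell _ _)] at h
  swap
  · filter_upwards [hd] with x hx
    simp only [hx.1, Pi.zero_apply]
    exact energy_density_nonneg L₀ (fun i j => η.1 i j x) hx.2
  have hz : ∀ᵐ x ∂(volume.restrict C.V), ∀ i j, η.1 i j x = 0 := by
    filter_upwards [h, hd] with x h0 hx i j
    by_contra hne
    have hp := L₀.pos_def (fun i j => η.1 i j x) hx.2 fun h0 => hne (congrFun (congrFun h0 i) j)
    simp only [hx.1, Pi.zero_apply] at h0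
    exact hp.ne' h0
  refine Subtype.ext (funext fun i => funext fun j => ?_)
  obtain ⟨g, hfg, hg⟩ := exists_periodic_rep (η.2.2 i j)
  have h0 : (volume : Measure (Space d)) {x | g x ≠ 0} = 0 := by
    refine C.fills.measure_zero_of_invariant _ (fun Y => ?_) ?_
    · ext x
      rw [Set.mem_vadd_set_iff_neg_vadd_mem, Set.mem_ofPred_eq, Set.mem_ofPred_eq, hg]
    · have h1 : ∀ᵐ x ∂(volume.restrict C.V), g x = 0 := by
        filter_upwards [hz, ae_restrict_of_ae hfg] with x a b
        rw [← b, a]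
      rw [← Measure.restrict_apply₀' C.fills.nullMeasurableSet]
      exact h1
  refine AEEqFun.ext ?_
  have h2 : ∀ᵐ x, g x = 0 := h0
  filter_upwards [h2, hfg, AEEqFun.coeFn_zero (μ := (volume : Measure (Space d))) (β := ℝ)]
    with x a b c
  exact (b.trans a).trans c.symm

/-- The energetic scalar product `(η, ζ) = ⟨L₀ η : ζ⟩` on symmetric `L²_per(V)` tensor fields. -/
@[reducible] def energeticCore (C : UnitCell d) (L₀ : Stiffness d) :
    InnerProductSpace.Core ℝ (TensorField C) where
  inner η ζ := pairing (L₀.act η) ζ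
  conj_inner_symm η ζ := pairing_act_comm L₀ ζ η
  re_inner_nonneg η := pairing_act_self_nonneg L₀ η
  add_left η ζ ξ := by rw [act_add, pairing_add_left]
  smul_left η ζ r := by rw [act_smul, pairing_smul_left]; rfl
  definite η h := eq_zero_of_pairing_act_self L₀ η h

/-- The space `H_e` of strain fields: symmetric `L²_per(V)` tensor fields
endowed with the energetic scalar product of the reference stiffness `L₀`. -/
def StrainSpace (C : UnitCell d) (_L₀ : Stiffness d) : Type := TensorField C

/-- The space `H_s` of stress fields, dual to `H_e` through the duality product `pairing`. -/
abbrev StressSpace (C : UnitCell d) : Type := TensorField C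

instance (C : UnitCell d) (L₀ : Stiffness d) : NormedAddCommGroup (StrainSpace C L₀) :=
  @InnerProductSpace.Core.toNormedAddCommGroup ℝ (TensorField C) _ _ _ (energeticCore C L₀)

instance (C : UnitCell d) (L₀ : Stiffness d) : InnerProductSpace ℝ (StrainSpace C L₀) :=
  @InnerProductSpace.ofCore ℝ (TensorField C) _ _ _ (energeticCore C L₀).toCore

/-- A strain field seen as a plain tensor field. -/
def StrainSpace.field {C : UnitCell d} {L₀ : Stiffness d} (η : StrainSpace C L₀) : TensorField C := η

/-- The heterogeneous elasticity tensor acting locally on a strain field: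
`(L η)_{ij}(x) = ∑_{kl} L_{ijkl}(x) η_{kl}(x)`. -/
def ElasticityField.act {C : UnitCell d} (L : ElasticityField C) (η : TensorField C) :
    StressSpace C :=
  ⟨fun i j => ∑ k, ∑ l,
      AEEqFun.mk (L.c i j k l) (L.bounded i j k l).aestronglyMeasurable * η.1 k l,
    fun i j => Finset.sum_congr rfl fun k _ => Finset.sum_congr rfl fun l _ => by
      congr 1
      exact AEEqFun.mk_eq_mk.2 (L.minor_left i j k l),
    fun i j => Submodule.sum_mem _ fun k _ => Submodule.sum_mem _ fun l _ => by
      have hm := AEEqFun.coeFn_mul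
        (AEEqFun.mk (L.c i j k l) (L.bounded i j k l).aestronglyMeasurable) (η.1 k l)
      have hk := AEEqFun.coeFn_mk (L.c i j k l) (L.bounded i j k l).aestronglyMeasurable
      have he : ∀ᵐ x, (AEEqFun.mk (L.c i j k l) (L.bounded i j k l).aestronglyMeasurable
          * η.1 k l : Space d →ₘ[volume] ℝ) x = L.c i j k l x * η.1 k l x := by
        filter_upwards [hm, hk] with x a b
        rw [a, Pi.mul_apply, b]
      refine ⟨fun K hK => ?_, fun Y hY => ?_⟩
      · refine (memLp_congr_ae (ae_restrict_of_ae he)).2 ?_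
        exact MemLp.mul' ((η.2.2 k l).1 K hK) ((L.bounded i j k l).restrict K)
      · filter_upwards [he, (measurePreserving_add_right volume Y).quasiMeasurePreserving.ae he,
          L.periodic i j k l Y hY, (η.2.2 k l).2 Y hY] with x a b c e
        rw [a, b, c, e]⟩

/-! ### Kinematically and statically admissible fields -/

/-- The classical partial derivative `∂_j φ`. -/
def partialDeriv (j : Fin d) (φ : Space d → ℝ) (x : Space d) : ℝ :=
  fderiv ℝ φ x (EuclideanSpace.single j 1)

/-- Test functions: smooth and compactly supported on `ℝ^d`. -/
def IsTest (φ : Space d → ℝ) : Prop := ContDiff ℝ ∞ φ ∧ HasCompactSupport φ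

/-- `g` is the weak (distributional) partial derivative `∂_j f` on `ℝ^d`. -/
def IsWeakPartial (j : Fin d) (f g : Space d →ₘ[volume] ℝ) : Prop :=
  ∀ φ : Space d → ℝ, IsTest φ → ∫ x, f x * partialDeriv j φ x = - ∫ x, g x * φ x

lemma IsTest.integrable_mul {C : UnitCell d} {f : Space d →ₘ[volume] ℝ} (hf : f ∈ L2per C)
    {φ : Space d → ℝ} (hφ : Continuous φ) (hc : HasCompactSupport φ) :
    Integrable (fun x => f x * φ x) volume := by
  have hl : LocallyIntegrable f volume := by
    rw [locallyIntegrable_iff]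
    intro K hK
    have : IsFiniteMeasure (volume.restrict K) := ⟨by simpa using hK.measure_lt_top⟩
    exact (hf.1 K hK).integrable (by norm_num)
  have := hl.integrable_smul_left_of_hasCompactSupport hφ hc
  simpa [mul_comm] using this

lemma IsTest.continuous_partialDeriv {φ : Space d → ℝ} (hφ : IsTest φ) (j : Fin d) :
    Continuous (partialDeriv j φ) :=
  (hφ.1.continuous_fderiv (by simp)).clm_apply continuous_const

lemma IsTest.hasCompactSupport_partialDeriv {φ : Space d → ℝ} (hφ : IsTest φ) (j : Fin d) :
    HasCompactSupport (partialDeriv j φ) :=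
  hφ.2.fderiv_apply (𝕜 := ℝ) _

lemma integral_add_mul_test {C : UnitCell d} {f g : Space d →ₘ[volume] ℝ} (hf : f ∈ L2per C)
    (hg : g ∈ L2per C) {φ : Space d → ℝ} (hφ : Continuous φ) (hc : HasCompactSupport φ) :
    ∫ x, (f + g) x * φ x = (∫ x, f x * φ x) + ∫ x, g x * φ x := by
  rw [← integral_add (IsTest.integrable_mul hf hφ hc) (IsTest.integrable_mul hg hφ hc)]
  refine integral_congr_ae ?_
  filter_upwards [AEEqFun.coeFn_add f g] with x hx
  simp only [hx, Pi.add_apply, add_mul]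

lemma integral_smul_mul_test (r : ℝ) (f : Space d →ₘ[volume] ℝ) (φ : Space d → ℝ) :
    ∫ x, (r • f) x * φ x = r * ∫ x, f x * φ x := by
  rw [← integral_const_mul]
  refine integral_congr_ae ?_
  filter_upwards [AEEqFun.coeFn_smul r f] with x hx
  simp only [hx, Pi.smul_apply, smul_eq_mul, mul_assoc]

lemma integral_zero_mul_test (φ : Space d → ℝ) :
    ∫ x, (0 : Space d →ₘ[volume] ℝ) x * φ x = 0 := by
  have h := integral_smul_mul_test 0 (0 : Space d →ₘ[volume] ℝ) φ
  rwa [zero_smul, zero_mul] at h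

/-- `w ∈ H¹_per(V)^d` has the gradient `G`, that is, `G i j = ∂_j w_i` weakly,
all functions being in `L²_per(V)`. -/
structure IsPeriodicDisplacement (C : UnitCell d) (w : Fin d → (Space d →ₘ[volume] ℝ))
    (G : Fin d → Fin d → (Space d →ₘ[volume] ℝ)) : Prop where
  mem : ∀ i, w i ∈ L2per C
  grad_mem : ∀ i j, G i j ∈ L2per C
  grad : ∀ i j, IsWeakPartial j (w i) (G i j)

/-- `E₀`: strain fields `½ (∇w + ∇wᵀ)` deriving from a periodic displacement `w ∈ H¹_per(V)^d`. -/
def E0 (C : UnitCell d) (L₀ : Stiffness d) : Submodule ℝ (StrainSpace C L₀) where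
  carrier := {e | ∃ w G, IsPeriodicDisplacement C w G ∧
    ∀ i j, e.field.1 i j = (1 / 2 : ℝ) • (G i j + G j i)}
  zero_mem' := by
    refine ⟨0, 0, ⟨fun _ => (L2per C).zero_mem, fun _ _ => (L2per C).zero_mem, ?_⟩, fun i j => ?_⟩
    · intro i j φ hφ
      simp only [Pi.zero_apply, integral_zero_mul_test, neg_zero]
    · simp only [Pi.zero_apply, add_zero, smul_zero]; rfl
  add_mem' := by
    rintro e e' ⟨w, G, h, he⟩ ⟨w', G', h', he'⟩
    refine ⟨w + w', G + G', ⟨fun i => (L2per C).add_mem (h.mem i) (h'.mem i),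
      fun i j => (L2per C).add_mem (h.grad_mem i j) (h'.grad_mem i j), ?_⟩, fun i j => ?_⟩
    · intro i j φ hφ
      simp only [Pi.add_apply]
      rw [integral_add_mul_test (h.mem i) (h'.mem i) (hφ.continuous_partialDeriv j)
        (hφ.hasCompactSupport_partialDeriv j), integral_add_mul_test (h.grad_mem i j)
        (h'.grad_mem i j) hφ.1.continuous hφ.2, h.grad i j φ hφ, h'.grad i j φ hφ]
      ring
    · have : (e + e').field.1 i j = e.field.1 i j + e'.field.1 i j := rfl
      rw [this, he, he', ← smul_add]
      congr 1
      simp only [Pi.add_apply]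
      abel
  smul_mem' := by
    rintro r e ⟨w, G, h, he⟩
    refine ⟨r • w, r • G, ⟨fun i => (L2per C).smul_mem r (h.mem i),
      fun i j => (L2per C).smul_mem r (h.grad_mem i j), ?_⟩, fun i j => ?_⟩
    · intro i j φ hφ
      simp only [Pi.smul_apply]
      rw [integral_smul_mul_test, integral_smul_mul_test, h.grad i j φ hφ]
      ring
    · have : (r • e).field.1 i j = r • e.field.1 i j := rfl
      rw [this, he, smul_comm]
      simp only [Pi.smul_apply, smul_add]

/-- Uniform (constant) tensor fields. -/
def uniformFields (C : UnitCell d) : Submodule ℝ (TensorField C) where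
  carrier := {η | ∃ a : Fin d → Fin d → ℝ, ∀ i j, η.1 i j = AEEqFun.const (Space d) (a i j)}
  zero_mem' := ⟨0, fun _ _ => rfl⟩
  add_mem' := by
    rintro η ζ ⟨a, ha⟩ ⟨b, hb⟩
    refine ⟨a + b, fun i j => ?_⟩
    have : (η + ζ).1 i j = η.1 i j + ζ.1 i j := rfl
    rw [this, ha, hb]; rfl
  smul_mem' := by
    rintro r η ⟨a, ha⟩
    refine ⟨r • a, fun i j => ?_⟩
    have : (r • η).1 i j = r • η.1 i j := rfl
    rw [this, ha]; rfl

/-- `U_e`: the uniform strain fields. -/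
def Ue (C : UnitCell d) (L₀ : Stiffness d) : Set (StrainSpace C L₀) :=
  {η | η.field ∈ uniformFields C}

/-- `S₀`: the self-equilibrated stress fields. They have zero average over `V`, and their periodic
extension to `ℝ^d` is divergence-free in the sense of distributions, which encodes both
`div s = 0` in `V` and the anti-periodicity of the tractions `s · n` on `∂V`. -/
def S0 (C : UnitCell d) : Submodule ℝ (StressSpace C) where
  carrier := {s | (∀ φ : Space d → ℝ, IsTest φ → ∀ i,
      ∑ j, ∫ x, s.1 i j x * partialDeriv j φ x = 0) ∧
    ∀ i j, ⨍ x in C.V, s.1 i j x = 0}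
  zero_mem' := by
    refine ⟨fun φ hφ i => Finset.sum_eq_zero fun j _ => integral_zero_mul_test _, fun i j => ?_⟩
    rw [setAverage_eq]
    have : ∫ x in C.V, (0 : Space d →ₘ[volume] ℝ) x = 0 :=
      integral_eq_zero_of_ae (ae_restrict_of_ae AEEqFun.coeFn_zero)
    exact smul_eq_zero_of_right _ this
  add_mem' := by
    rintro s t ⟨hs, hs'⟩ ⟨ht, ht'⟩
    refine ⟨fun φ hφ i => ?_, fun i j => ?_⟩
    · have := congrArg₂ (· + ·) (hs φ hφ i) (ht φ hφ i)
      simp only [add_zero, ← Finset.sum_add_distrib] at this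
      rw [← this]
      exact Finset.sum_congr rfl fun j _ => integral_add_mul_test (s.2.2 i j) (t.2.2 i j)
        (hφ.continuous_partialDeriv j) (hφ.hasCompactSupport_partialDeriv j)
    · have hfin : IsFiniteMeasure (volume.restrict C.V) := by
        refine ⟨?_⟩
        rw [Measure.restrict_apply_univ, lt_top_iff_ne_top]
        intro h
        exact volume_cell_ne_zero C (by rw [measureReal_def, h, ENNReal.toReal_top])
      have h1 := (memLp_cell (s.2.2 i j)).integrable (by norm_num)
      have h2 := (memLp_cell (t.2.2 i j)).integrable (by norm_num)
      have h3 : ∫ x in C.V, (s + t).1 i j x = (∫ x in C.V, s.1 i j x) + ∫ x in C.V, t.1 i j x := by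
        rw [← integral_add h1 h2]
        exact integral_congr_ae (ae_restrict_of_ae (AEEqFun.coeFn_add (s.1 i j) (t.1 i j)))
      have h4 := congrArg₂ (· + ·) (hs' i j) (ht' i j)
      simp only [setAverage_eq, ← smul_add, add_zero] at h4
      rw [setAverage_eq, h3, h4]
  smul_mem' := by
    rintro r s ⟨hs, hs'⟩
    refine ⟨fun φ hφ i => ?_, fun i j => ?_⟩
    · have := congrArg (r * ·) (hs φ hφ i)
      simp only [mul_zero, Finset.mul_sum] at this
      rw [← this]
      exact Finset.sum_congr rfl fun j _ => integral_smul_mul_test r (s.1 i j) _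
    · have h3 : ∫ x in C.V, (r • s).1 i j x = r * ∫ x in C.V, s.1 i j x := by
        rw [← integral_const_mul]
        exact integral_congr_ae (ae_restrict_of_ae (AEEqFun.coeFn_smul r (s.1 i j)))
      have h4 := hs' i j
      rw [setAverage_eq, smul_eq_mul] at h4
      rw [setAverage_eq, h3, smul_eq_mul, mul_left_comm, h4, mul_zero]

/-- `S = U_s ⊕ S₀`: the statically admissible stress fields. -/
def S (C : UnitCell d) : Submodule ℝ (StressSpace C) := uniformFields C ⊔ S0 C

/-! ### The strain Green's operator and the functionals -/

/-- `e` solves the Eshelby problem with datum `τ`: `e ∈ E₀` and `L₀ e - τ ∈ S`. -/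
def SolvesEshelby {C : UnitCell d} {L₀ : Stiffness d} (τ : StressSpace C) (e : E0 C L₀) : Prop :=
  L₀.act e.1.field - τ ∈ S C

open Classical in
/-- The strain Green's operator `Γ₀`: `Γ₀ τ` is the solution of the Eshelby problem with datum `τ`.
(The value `0` is a placeholder, in case there were no solution.) -/
def green {C : UnitCell d} (L₀ : Stiffness d) (τ : StressSpace C) : E0 C L₀ :=
  if h : ∃ e : E0 C L₀, SolvesEshelby τ e then h.choose else 0

/-- The stress field `L (ε̄ + e*)`. -/
def stress {C : UnitCell d} {L₀ : Stiffness d} (L : ElasticityField C)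
    (εbar : StrainSpace C L₀) (e : E0 C L₀) : StressSpace C :=
  L.act (εbar + (e : StrainSpace C L₀)).field

/-- The energy `J(e*) = ½ ⟨L (ε̄ + e*), ε̄ + e*⟩` on `E₀`. -/
def J {C : UnitCell d} {L₀ : Stiffness d} (L : ElasticityField C)
    (εbar : StrainSpace C L₀) (e : E0 C L₀) : ℝ :=
  1 / 2 * pairing (stress L εbar e) (εbar + (e : StrainSpace C L₀)).field

/-- `g ∈ E₀` is a gradient at `e` of the functional `F` on `E₀`, for the energetic scalar product:
`(g, h) = lim_{t → 0} (F (e + t h) - F e) / t` for every direction `h ∈ E₀`. -/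
def IsGradientAt {C : UnitCell d} {L₀ : Stiffness d} (F : E0 C L₀ → ℝ) (e g : E0 C L₀) : Prop :=
  ∀ h : E0 C L₀, Tendsto (fun t : ℝ => (F (e + t • h) - F e) / t) (𝓝[≠] 0) (𝓝 (inner ℝ g h))

open Classical in
/-- The gradient at `e` of a functional on `E₀` (with placeholder `0` where there is none). -/
def grad {C : UnitCell d} {L₀ : Stiffness d} (F : E0 C L₀ → ℝ) (e : E0 C L₀) : E0 C L₀ :=
  if h : ∃ g : E0 C L₀, IsGradientAt F e g then h.choose else 0

/-- The geometric functional `N(e*) = ½ ‖∇J(e*)‖²` on `E₀`. -/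
def N {C : UnitCell d} {L₀ : Stiffness d} (L : ElasticityField C)
    (εbar : StrainSpace C L₀) (e : E0 C L₀) : ℝ :=
  1 / 2 * ‖grad (J L εbar) e‖ ^ 2

end Homogenization

end

noncomputable section

namespace Homogenization

open scoped Pointwise

variable {d : ℕ}

-- The heart of the matter is that `S C` is exactly the annihilator of `E0 C L₀` under the virtual
-- work `pairing` (`pairing_eq_zero_of_mem` and `mem_S_of_pairing_eq_zero`). Since `pairing (L₀.act
-- e) h` is the energetic scalar product, the Eshelby problem for `τ` then says `(e, h) = ⟨τ : h⟩`
-- for all `h` in `E0` (`solvesEshelby_iff`), and the Riesz representation theorem on `E0` gives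
-- existence and uniqueness, provided that `E0` is complete.
--
-- Both the duality and the completeness are read off Fourier series. Periodic functions are
-- transported to the torus with its normalized Haar measure, and test functions on `ℝ^d` enter
-- through their periodizations. A weak derivative `∂_j` becomes multiplication by `i κ_j`, where
-- `κ` is the wave vector. A stress is divergence-free when its coefficients annihilate `κ`; a
-- strain is compatible when each coefficient is `i` times the symmetrized product of `κ` with some
-- vector. The two conditions are dual by Parseval. The vector is an explicit linear function of the
-- strain coefficient (`amplitude`), so that compatibility is a closed condition; the bounds on
-- `amplitude`, together with a lower bound on the nonzero wave vectors, rebuild a displacement in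
-- `H¹` from a compatible field. Completeness of the whole strain space follows from the equivalence
-- of the energetic and the `L²` norms.
--
-- The gradients are then algebra: `J` and `N` are quadratic along lines, and the major symmetry of
-- `L` makes `Γ₀ L` self-adjoint on `E0`.

local instance : MeasureSpace UnitAddCircle := ⟨AddCircle.haarAddCircle⟩

local instance : Measure.IsAddHaarMeasure (volume : Measure UnitAddCircle) :=
  inferInstanceAs (Measure.IsAddHaarMeasure AddCircle.haarAddCircle)

local instance : IsProbabilityMeasure (volume : Measure UnitAddCircle) :=
  inferInstanceAs (IsProbabilityMeasure AddCircle.haarAddCircle)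

/-! ### Periodic functions as functions on the torus -/

/-- The torus `ℝ^d / ℤ^d`. -/
abbrev Torus (d : ℕ) := UnitAddTorus (Fin d)

/-- The standard half-open fundamental cell of the lattice of periods. -/
abbrev UnitCell.box (C : UnitCell d) : Set (Space d) := ZSpan.fundamentalDomain C.Y

/-- The projection of `ℝ^d` onto the torus, in lattice coordinates. -/
def UnitCell.toTorus (C : UnitCell d) (x : Space d) : Torus d :=
  fun j => ((C.Y.repr x j : ℝ) : UnitAddCircle)

/-- A measurable section of the projection onto the torus. -/
def UnitCell.cellMap (C : UnitCell d) (t : Torus d) : Space d :=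
  C.Y.equivFun.symm (UnitAddTorus.measurableEquivPiIoc 0 t).1

lemma UnitCell.toTorus_cellMap (C : UnitCell d) (t : Torus d) : C.toTorus (C.cellMap t) = t := by
  have h := (UnitAddTorus.measurableEquivPiIoc (0 : Fin d → ℝ)).symm_apply_apply t
  rw [UnitAddTorus.coe_symm_measurableEquivPiIoc_apply] at h
  conv_rhs => rw [← h]
  funext j
  have : C.Y.repr (C.cellMap t) j = (UnitAddTorus.measurableEquivPiIoc 0 t).1 j := by
    rw [← C.Y.equivFun_apply, UnitCell.cellMap, LinearEquiv.apply_symm_apply]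
  rw [UnitCell.toTorus, this]

lemma UnitCell.measurable_equivFun_symm (C : UnitCell d) : Measurable C.Y.equivFun.symm :=
  (LinearMap.continuous_of_finiteDimensional C.Y.equivFun.symm.toLinearMap).measurable

lemma UnitCell.measurable_cellMap (C : UnitCell d) : Measurable C.cellMap :=
  C.measurable_equivFun_symm.comp
    (measurable_subtype_coe.comp (UnitAddTorus.measurableEquivPiIoc 0).measurable)

lemma UnitCell.continuous_coord (C : UnitCell d) (j : Fin d) :
    Continuous fun x => C.Y.repr x j :=
  LinearMap.continuous_of_finiteDimensional (C.Y.coord j)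

lemma UnitCell.continuous_toTorus (C : UnitCell d) : Continuous C.toTorus :=
  continuous_pi fun j => (AddCircle.continuous_mk' 1).comp (C.continuous_coord j)

lemma UnitCell.toTorus_vadd (C : UnitCell d) (Y : C.lattice) (x : Space d) :
    C.toTorus (Y +ᵥ x) = C.toTorus x := by
  funext j
  obtain ⟨n, hn⟩ := (C.Y.mem_span_iff_repr_mem ℤ (Y : Space d)).1 Y.2 j
  rw [UnitCell.toTorus, UnitCell.toTorus, Submodule.vadd_def, vadd_eq_add, map_add,
    Finsupp.add_apply, ← hn, AddCircle.coe_add]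
  simp only [algebraMap_int_eq, eq_intCast, add_eq_right]
  rw [AddCircle.coe_eq_zero_iff]
  exact ⟨n, by simp⟩

lemma UnitCell.volume_box_ne_zero (C : UnitCell d) : volume C.box ≠ 0 :=
  ZSpan.measure_fundamentalDomain_ne_zero C.Y

lemma UnitCell.volume_box_ne_top (C : UnitCell d) : volume C.box ≠ ⊤ :=
  (ZSpan.fundamentalDomain_isBounded C.Y).measure_lt_top.ne

/-- In lattice coordinates the torus carries Lebesgue measure on a unit cube, and a linear change of
coordinates sends Lebesgue measure to a multiple of itself. No determinant is needed: both sides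
have total mass one, which fixes the multiple. -/
lemma UnitCell.map_cellMap (C : UnitCell d) :
    (volume : Measure (Torus d)).map C.cellMap = (volume C.box)⁻¹ • volume.restrict C.box := by
  set e : (Fin d → ℝ) ≃L[ℝ] Space d := C.Y.equivFun.symm.toContinuousLinearEquiv
  have hme : MeasurableEmbedding e := e.toHomeomorph.measurableEmbedding
  have h1 : (volume : Measure (Torus d)).map C.cellMap =
      ((volume : Measure (Fin d → ℝ)).restrict
        {x | ∀ i, x i ∈ Set.Ioc ((0 : Fin d → ℝ) i) ((0 : Fin d → ℝ) i + 1)}).map e := by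
    have a := map_comap_subtype_coe (MeasurableSet.univ_pi' fun i : Fin d =>
      measurableSet_Ioc (a := (0 : Fin d → ℝ) i) (b := (0 : Fin d → ℝ) i + 1)) volume
    have b := (UnitAddTorus.measurePreserving_equivPiIoc (0 : Fin d → ℝ)).map_eq
    have c : (volume : Measure (Torus d)).map
        (Subtype.val ∘ UnitAddTorus.measurableEquivPiIoc (0 : Fin d → ℝ)) = volume.restrict
          {x | ∀ i, x i ∈ Set.Ioc ((0 : Fin d → ℝ) i) ((0 : Fin d → ℝ) i + 1)} := by
      rw [← Measure.map_map measurable_subtype_coe (MeasurableEquiv.measurable _), b]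
      exact a
    rw [← c, Measure.map_map hme.measurable
      (measurable_subtype_coe.comp (MeasurableEquiv.measurable _))]
    rfl
  -- The section of the torus takes values in `(0,1]^d` while the box is the image of `[0,1)^d`; the
  -- two cubes differ by a null set.
  have h2 : (volume : Measure (Fin d → ℝ)).restrict
        {x | ∀ i, x i ∈ Set.Ioc ((0 : Fin d → ℝ) i) ((0 : Fin d → ℝ) i + 1)} =
      (volume : Measure (Fin d → ℝ)).restrict (e ⁻¹' C.box) := by
    refine Measure.restrict_congr_set ?_
    have a1 := Measure.univ_pi_Ioc_ae_eq_Icc (μ := fun _ : Fin d => (volume : Measure ℝ))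
      (f := 0) (g := 1)
    have a2 := Measure.univ_pi_Ico_ae_eq_Icc (μ := fun _ : Fin d => (volume : Measure ℝ))
      (f := 0) (g := 1)
    have a3 := a1.trans a2.symm
    have e1 : {x | ∀ i, x i ∈ Set.Ioc ((0 : Fin d → ℝ) i) ((0 : Fin d → ℝ) i + 1)} =
        Set.univ.pi fun i => Set.Ioc ((0 : Fin d → ℝ) i) ((1 : Fin d → ℝ) i) := by
      ext x
      simp [Set.mem_pi]
    have e2 : e ⁻¹' C.box =
        Set.univ.pi fun i => Set.Ico ((0 : Fin d → ℝ) i) ((1 : Fin d → ℝ) i) := by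
      ext x
      rw [Set.mem_preimage, UnitCell.box, ZSpan.mem_fundamentalDomain, Set.mem_univ_pi]
      refine forall_congr' fun i => ?_
      have : C.Y.repr (e x) i = x i := by
        rw [← C.Y.equivFun_apply]
        exact congrFun (C.Y.equivFun.apply_symm_apply x) i
      rw [this]
      rfl
    rw [e1, e2]
    exact a3
  have hbm : MeasurableSet C.box := ZSpan.fundamentalDomain_measurableSet C.Y
  have hH : ((volume : Measure (Fin d → ℝ)).map e).IsAddHaarMeasure :=
    e.isAddHaarMeasure_map volume
  have h3 := Measure.isAddLeftInvariant_eq_smul ((volume : Measure (Fin d → ℝ)).map e)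
    (volume : Measure (Space d))
  set c := Measure.addHaarScalarFactor ((volume : Measure (Fin d → ℝ)).map e)
    (volume : Measure (Space d))
  have h4 : (volume : Measure (Torus d)).map C.cellMap = c • volume.restrict C.box := by
    rw [h1, h2, ← Measure.restrict_map hme.measurable hbm, h3, Measure.restrict_smul]
  have h5 : (c : ℝ≥0∞) * volume C.box = 1 := by
    have := congrArg (fun μ => μ Set.univ) h4
    simp only [Measure.map_apply C.measurable_cellMap MeasurableSet.univ, Set.preimage_univ,
      measure_univ, Measure.smul_apply, Measure.restrict_apply MeasurableSet.univ,
      Set.univ_inter] at this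
    rw [this]; rfl
  rw [h4, ← ENNReal.eq_inv_of_mul_eq_one_left h5]
  rfl

lemma UnitCell.quasiMeasurePreserving_cellMap (C : UnitCell d) :
    Measure.QuasiMeasurePreserving C.cellMap volume volume := by
  refine ⟨C.measurable_cellMap, ?_⟩
  rw [C.map_cellMap]
  exact (Measure.smul_absolutelyContinuous).trans Measure.restrict_le_self.absolutelyContinuous

lemma UnitCell.integral_cellMap {E : Type*} [NormedAddCommGroup E] [NormedSpace ℝ E]
    (C : UnitCell d) {h : Space d → E} (hm : AEStronglyMeasurable h volume) :
    ∫ t, h (C.cellMap t) = (volume.real C.box)⁻¹ • ∫ x in C.box, h x := by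
  have hm' : AEStronglyMeasurable h ((volume : Measure (Torus d)).map C.cellMap) :=
    hm.mono_ac C.quasiMeasurePreserving_cellMap.absolutelyContinuous
  rw [← integral_map C.measurable_cellMap.aemeasurable hm', C.map_cellMap, integral_smul_measure,
    ENNReal.toReal_inv]
  rfl

/-- Periodic functions have the same mean over all unit cells. -/
lemma UnitCell.setAverage_eq_integral_torus (C : UnitCell d) {h g : Space d → ℝ}
    (hm : AEStronglyMeasurable h volume) (hhg : h =ᵐ[volume] g)
    (hg : ∀ (Y : C.lattice) (x), g (Y +ᵥ x) = g x) :
    ⨍ x in C.V, h x = ∫ t, h (C.cellMap t) := by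
  have hF := ZSpan.isAddFundamentalDomain C.Y (volume : Measure (Space d))
  have hc : Countable C.lattice := inferInstance
  rw [C.integral_cellMap hm, setAverage_eq, measureReal_def, measureReal_def,
    C.fills.measure_eq hF]
  congr 1
  rw [integral_congr_ae (ae_restrict_of_ae hhg), integral_congr_ae (ae_restrict_of_ae hhg)]
  exact C.fills.setIntegral_eq hF hg

/-- Complex square-integrable functions on the torus. -/
abbrev TorusL2 (d : ℕ) := Lp ℂ 2 (volume : Measure (Torus d))

/-- Such a `Y` lies in the bounded set `B - A`, which contains finitely many lattice points. -/
lemma UnitCell.finite_lattice (C : UnitCell d) {A B : Set (Space d)}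
    (hA : Bornology.IsBounded A) (hB : Bornology.IsBounded B) :
    {Y : C.lattice | ∃ x ∈ A, Y +ᵥ x ∈ B}.Finite := by
  have h2 := ZSpan.setFinite_inter C.Y (hB.sub hA)
  refine (h2.preimage (Subtype.val_injective.injOn)).subset ?_
  rintro Y ⟨x, hx, hY⟩
  exact ⟨⟨_, hY, x, hx, add_sub_cancel_right _ _⟩, Y.2⟩

lemma memLp_cellMap {C : UnitCell d} {f : Space d →ₘ[volume] ℝ} (hf : f ∈ L2per C) :
    MemLp (fun t => f (C.cellMap t)) 2 volume := by
  have hK : IsCompact (closure C.box) :=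
    (ZSpan.fundamentalDomain_isBounded C.Y).isCompact_closure
  have h1 : MemLp f 2 (volume.restrict C.box) :=
    (hf.1 _ hK).mono_measure (Measure.restrict_mono subset_closure le_rfl)
  have h2 : MemLp f 2 ((volume : Measure (Torus d)).map C.cellMap) := by
    rw [C.map_cellMap]
    exact h1.smul_measure (ENNReal.inv_ne_top.2 C.volume_box_ne_zero)
  exact (memLp_map_measure_iff h2.1 C.measurable_cellMap.aemeasurable).1 h2

/-- A periodic function seen as a function on the torus. -/
def cellLp (C : UnitCell d) : L2per C →ₗ[ℝ] TorusL2 d where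
  toFun f := MemLp.toLp (fun t => ((f.1 (C.cellMap t) : ℝ) : ℂ)) (memLp_cellMap f.2).ofReal
  map_add' f g := by
    rw [← MemLp.toLp_add]
    refine MemLp.toLp_congr _ _ ?_
    filter_upwards [C.quasiMeasurePreserving_cellMap.ae (AEEqFun.coeFn_add f.1 g.1)] with t ht
    have : (f + g).1 (C.cellMap t) = f.1 (C.cellMap t) + g.1 (C.cellMap t) := ht
    rw [this, Complex.ofReal_add]
    rfl
  map_smul' r f := by
    rw [RingHom.id_apply, ← MemLp.toLp_const_smul]
    refine MemLp.toLp_congr _ _ ?_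
    filter_upwards [C.quasiMeasurePreserving_cellMap.ae (AEEqFun.coeFn_smul r f.1)] with t ht
    have : (r • f).1 (C.cellMap t) = r * f.1 (C.cellMap t) := ht
    rw [this, Complex.ofReal_mul, Pi.smul_apply, Complex.real_smul]

lemma coeFn_cellLp {C : UnitCell d} (f : L2per C) :
    cellLp C f =ᵐ[volume] fun t => ((f.1 (C.cellMap t) : ℝ) : ℂ) :=
  MemLp.coeFn_toLp (memLp_cellMap f.2).ofReal

lemma inner_cellLp {C : UnitCell d} (f g : L2per C) :
    inner ℂ (cellLp C f) (cellLp C g) =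
      ((∫ t, f.1 (C.cellMap t) * g.1 (C.cellMap t) : ℝ) : ℂ) := by
  rw [L2.inner_def, ← integral_complex_ofReal]
  refine integral_congr_ae ?_
  filter_upwards [coeFn_cellLp f, coeFn_cellLp g] with t h1 h2
  simp [h1, h2, mul_comm]

/-- A component of a tensor field as a function on the torus. -/
def comp (C : UnitCell d) (i j : Fin d) : TensorField C →ₗ[ℝ] TorusL2 d where
  toFun η := cellLp C ⟨η.1 i j, η.2.2 i j⟩
  map_add' η ζ := by rw [← map_add]; rfl
  map_smul' r η := by rw [RingHom.id_apply, ← map_smul]; rfl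

lemma comp_symm {C : UnitCell d} (i j : Fin d) (η : TensorField C) :
    comp C i j η = comp C j i η := by
  simp only [comp, LinearMap.coe_mk, AddHom.coe_mk, η.2.1 i j]

/-- This carries virtual work to the torus, where Parseval's identity applies. The components are
real-valued, so taking the real part loses nothing. -/
lemma pairing_eq_inner {C : UnitCell d} (τ η : TensorField C) :
    pairing τ η = ∑ i, ∑ j, (inner ℂ (comp C i j τ) (comp C i j η)).re := by
  choose g hg hg' using fun i j => exists_periodic_rep (τ.2.2 i j)
  choose k hk hk' using fun i j => exists_periodic_rep (η.2.2 i j)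
  have hm : AEStronglyMeasurable (fun x => ∑ i, ∑ j, τ.1 i j x * η.1 i j x) volume := by
    refine Finset.aestronglyMeasurable_fun_sum _ fun i _ =>
      Finset.aestronglyMeasurable_fun_sum _ fun j _ => ?_
    exact (τ.1 i j).aestronglyMeasurable.mul (η.1 i j).aestronglyMeasurable
  rw [pairing, C.setAverage_eq_integral_torus hm
    (g := fun x => ∑ i, ∑ j, g i j x * k i j x) ?_ fun Y x => by simp only [hg', hk']]
  · have hi : ∀ i j, Integrable (fun t => τ.1 i j (C.cellMap t) * η.1 i j (C.cellMap t)) volume :=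
      fun i j => (memLp_cellMap (τ.2.2 i j)).integrable_mul (memLp_cellMap (η.2.2 i j))
    rw [integral_finsetSum _ fun i _ => integrable_finsetSum _ fun j _ => hi i j]
    refine Finset.sum_congr rfl fun i _ => ?_
    rw [integral_finsetSum _ fun j _ => hi i j]
    refine Finset.sum_congr rfl fun j _ => ?_
    simp only [comp, LinearMap.coe_mk, AddHom.coe_mk]
    rw [inner_cellLp, Complex.ofReal_re]
  · filter_upwards [ae_all_iff.2 fun i => ae_all_iff.2 fun j => hg i j,
      ae_all_iff.2 fun i => ae_all_iff.2 fun j => hk i j] with x h1 h2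
    simp only [h1, h2]

/-- A compact set is covered by finitely many translates of the box, and by invariance `f ^ 2` is
integrable on each of them. -/
lemma memLp_restrict_of_box (C : UnitCell d) {f : Space d → ℝ}
    (hm : AEStronglyMeasurable f volume) (hf : ∀ (Y : C.lattice) (x), f (Y +ᵥ x) = f x)
    (hb : MemLp f 2 (volume.restrict C.box)) {K : Set (Space d)} (hK : IsCompact K) :
    MemLp f 2 (volume.restrict K) := by
  have hF := ZSpan.isAddFundamentalDomain C.Y (volume : Measure (Space d))
  have hc : Countable C.lattice := inferInstance
  rw [memLp_two_iff_integrable_sq hm.restrict] at hb ⊢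
  have hfin := C.finite_lattice (ZSpan.fundamentalDomain_isBounded C.Y) hK.isBounded
  have h1 : IntegrableOn (fun x => f x ^ 2)
      (⋃ Y ∈ {Y : C.lattice | ∃ x ∈ C.box, Y +ᵥ x ∈ K}, (Y +ᵥ C.box)) volume := by
    rw [integrableOn_finite_biUnion hfin]
    intro Y _
    exact (hF.integrableOn_iff (hF.vadd_of_comm Y) fun Z x => by rw [hf]).1 hb
  refine IntegrableOn.mono_set h1 fun x hx => ?_
  obtain ⟨Y, hY, -⟩ := ZSpan.exist_unique_vadd_mem_fundamentalDomain C.Y x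
  have hx' : x = -Y +ᵥ (Y +ᵥ x) := (neg_vadd_vadd Y x).symm
  refine Set.mem_biUnion (x := -Y) ⟨Y +ᵥ x, hY, ?_⟩ ?_
  · rwa [← hx']
  · rw [hx']
    exact Set.vadd_mem_vadd_set hY

/-- The periodic function on `ℝ^d` given by the real part of a function on the torus. -/
def periodicRe (C : UnitCell d) (u : TorusL2 d) : L2per C :=
  ⟨AEEqFun.mk (fun x => (u (C.toTorus x)).re)
      (Complex.measurable_re.comp
        ((Lp.stronglyMeasurable u).measurable.comp
          C.continuous_toTorus.measurable)).aestronglyMeasurable, by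
    have hmeas : Measurable (fun x => (u (C.toTorus x)).re) := Complex.measurable_re.comp
        ((Lp.stronglyMeasurable u).measurable.comp C.continuous_toTorus.measurable)
    have hinv : ∀ (Y : C.lattice) (x), (u (C.toTorus (Y +ᵥ x))).re = (u (C.toTorus x)).re :=
      fun Y x => by rw [C.toTorus_vadd]
    have hmk := AEEqFun.coeFn_mk _ (hmeas.aestronglyMeasurable (μ := (volume : Measure (Space d))))
    refine ⟨fun K hK => (memLp_congr_ae (ae_restrict_of_ae hmk)).2 ?_, fun Y hY => ?_⟩
    · refine memLp_restrict_of_box C hmeas.aestronglyMeasurable hinv ?_ hK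
      have h1 : MemLp (fun x => (u (C.toTorus x)).re) 2
          ((volume : Measure (Torus d)).map C.cellMap) := by
        refine (memLp_map_measure_iff hmeas.aestronglyMeasurable
          C.measurable_cellMap.aemeasurable).2 ?_
        have : ((fun x => (u (C.toTorus x)).re) ∘ C.cellMap) = fun t => (u t).re := by
          funext t
          simp [C.toTorus_cellMap]
        rw [this]
        exact (Lp.memLp u).re
      rw [C.map_cellMap] at h1
      have h2 := h1.smul_measure C.volume_box_ne_top
      rwa [smul_smul, ENNReal.mul_inv_cancel C.volume_box_ne_zero C.volume_box_ne_top,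
        one_smul] at h2
    · filter_upwards [hmk, (measurePreserving_add_right volume Y).quasiMeasurePreserving.ae hmk]
        with x a b
      rw [a, b]
      have := hinv ⟨Y, hY⟩ x
      rwa [Submodule.vadd_def, vadd_eq_add, add_comm] at this⟩

lemma coeFn_periodicRe (C : UnitCell d) (u : TorusL2 d) :
    (fun t => (periodicRe C u).1 (C.cellMap t)) =ᵐ[volume] fun t => (u t).re := by
  have := C.quasiMeasurePreserving_cellMap.ae (AEEqFun.coeFn_mk (fun x => (u (C.toTorus x)).re)
      (Complex.measurable_re.comp
        ((Lp.stronglyMeasurable u).measurable.comp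
          C.continuous_toTorus.measurable)).aestronglyMeasurable)
  filter_upwards [this] with t ht
  rw [C.toTorus_cellMap] at ht
  exact ht

/-- Real functions in `L²` of the torus. -/
lemma cellLp_periodicRe (C : UnitCell d) {u : TorusL2 d} (hu : ∀ᵐ t, (u t).im = 0) :
    cellLp C (periodicRe C u) = u := by
  refine Lp.ext ?_
  filter_upwards [coeFn_cellLp (periodicRe C u), coeFn_periodicRe C u, hu] with t h1 h2 h3
  rw [h1, h2]
  exact Complex.ext (by simp) (by simp [h3])

/-- Taking real parts does not increase the distance to a real function. In the completeness proof
this replaces a limit in complex `L²` by a real field without showing that the limit is real. -/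
lemma norm_cellLp_periodicRe_sub_le (C : UnitCell d) (u : TorusL2 d) (f : L2per C) :
    ‖cellLp C (periodicRe C u) - cellLp C f‖ ≤ ‖u - cellLp C f‖ := by
  refine Lp.norm_le_norm_of_ae_le ?_
  filter_upwards [coeFn_cellLp (periodicRe C u), coeFn_periodicRe C u, coeFn_cellLp f,
    Lp.coeFn_sub (cellLp C (periodicRe C u)) (cellLp C f), Lp.coeFn_sub u (cellLp C f)]
    with t h1 h2 h3 h4 h5
  rw [h4, h5, Pi.sub_apply, Pi.sub_apply, h1, h2, h3, ← Complex.ofReal_sub, Complex.norm_real]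
  have := Complex.abs_re_le_norm (u t - ((f.1 (C.cellMap t) : ℝ) : ℂ))
  rwa [Complex.sub_re, Complex.ofReal_re] at this

/-! ### Periodization of compactly supported functions -/

/-- The sum of the lattice translates of a function. -/
def periodization (C : UnitCell d) (φ : Space d → ℂ) (x : Space d) : ℂ :=
  ∑' Y : C.lattice, φ (Y +ᵥ x)

/-- Only finitely many translates of a bounded set meet the compact support, so the series is
locally a finite sum; this settles measurability, smoothness and every exchange of sum and integral.
-/
lemma exists_finset_periodization (C : UnitCell d) {φ : Space d → ℂ} (hc : HasCompactSupport φ)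
    {A : Set (Space d)} (hA : Bornology.IsBounded A) :
    ∃ Z : Finset C.lattice, (∀ Y ∉ Z, ∀ x ∈ A, φ (Y +ᵥ x) = 0) ∧
      ∀ x ∈ A, periodization C φ x = ∑ Y ∈ Z, φ (Y +ᵥ x) := by
  have hfin := C.finite_lattice hA hc.isCompact.isBounded
  have h0 : ∀ Y ∉ hfin.toFinset, ∀ x ∈ A, φ (Y +ᵥ x) = 0 := by
    intro Y hY x hx
    by_contra hne
    exact hY (hfin.mem_toFinset.2 ⟨x, hx, subset_tsupport φ hne⟩)
  exact ⟨hfin.toFinset, h0, fun x hx => tsum_eq_sum fun Y hY => h0 Y hY x hx⟩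

lemma periodization_vadd (C : UnitCell d) (φ : Space d → ℂ) (Y : C.lattice) (x : Space d) :
    periodization C φ (Y +ᵥ x) = periodization C φ x := by
  simp only [periodization, ← add_vadd]
  exact (Equiv.addRight Y).tsum_eq fun Z => φ (Z +ᵥ x)

lemma UnitCell.ae_cellMap_mem_box (C : UnitCell d) : ∀ᵐ t, C.cellMap t ∈ C.box := by
  refine ae_of_ae_map C.measurable_cellMap.aemeasurable ?_
  rw [C.map_cellMap]
  exact Measure.ae_smul_measure
    (ae_restrict_mem (ZSpan.fundamentalDomain_measurableSet C.Y)) _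

lemma measurable_vadd_lattice (C : UnitCell d) (Y : C.lattice) :
    Measurable fun x : Space d => Y +ᵥ x :=
  measurable_const_add (Y : Space d)

lemma continuous_vadd_lattice (C : UnitCell d) (Y : C.lattice) :
    Continuous fun x : Space d => Y +ᵥ x :=
  continuous_const_add (Y : Space d)

lemma exists_finset_periodization_cellMap (C : UnitCell d) {φ : Space d → ℂ}
    (hc : HasCompactSupport φ) :
    ∃ Z : Finset C.lattice, (∀ Y ∉ Z, ∀ x ∈ C.box, φ (Y +ᵥ x) = 0) ∧
      ∀ᵐ t, periodization C φ (C.cellMap t) = ∑ Y ∈ Z, φ (Y +ᵥ C.cellMap t) := by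
  obtain ⟨Z, h0, hZ⟩ := exists_finset_periodization C hc
    (ZSpan.fundamentalDomain_isBounded C.Y)
  refine ⟨Z, h0, ?_⟩
  filter_upwards [C.ae_cellMap_mem_box] with t ht
  exact hZ _ ht

lemma memLp_periodization (C : UnitCell d) {φ : Space d → ℂ} (hφ : Continuous φ)
    (hc : HasCompactSupport φ) :
    MemLp (fun t => periodization C φ (C.cellMap t)) 2 volume := by
  obtain ⟨Z, -, hZ⟩ := exists_finset_periodization_cellMap C hc
  refine (memLp_congr_ae hZ).2 (memLp_finsetSum _ fun Y _ => ?_)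
  obtain ⟨M, hM⟩ := hφ.bounded_above_of_compact_support hc
  exact MemLp.of_bound (hφ.measurable.comp ((measurable_vadd_lattice C Y).comp
    C.measurable_cellMap)).aestronglyMeasurable M (Eventually.of_forall fun t => hM _)

/-- The periodization of a compactly supported function as a function on the torus. -/
def perLp (C : UnitCell d) {φ : Space d → ℂ} (hφ : Continuous φ) (hc : HasCompactSupport φ) :
    TorusL2 d :=
  (memLp_periodization C hφ hc).toLp

lemma coeFn_perLp (C : UnitCell d) {φ : Space d → ℂ} (hφ : Continuous φ)
    (hc : HasCompactSupport φ) :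
    perLp C hφ hc =ᵐ[volume] fun t => periodization C φ (C.cellMap t) :=
  MemLp.coeFn_toLp _

/-- Integrals against a periodic function unfold. -/
lemma integral_mul_eq_integral_periodization (C : UnitCell d) {h g : Space d → ℂ}
    (hm : AEStronglyMeasurable h volume) (hhg : h =ᵐ[volume] g)
    (hg : ∀ (Y : C.lattice) (x), g (Y +ᵥ x) = g x) {φ : Space d → ℂ} (hφ : Continuous φ)
    (hc : HasCompactSupport φ) (hi : Integrable (fun x => h x * φ x) volume) :
    ∫ x, h x * φ x =
      volume.real C.box • ∫ t, h (C.cellMap t) * periodization C φ (C.cellMap t) := by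
  have hF := ZSpan.isAddFundamentalDomain C.Y (volume : Measure (Space d))
  have hcount : Countable C.lattice := inferInstance
  have hbm : MeasurableSet C.box := ZSpan.fundamentalDomain_measurableSet C.Y
  obtain ⟨Z, h0, hZ⟩ := exists_finset_periodization_cellMap C hc
  have hgm : AEStronglyMeasurable g volume := hm.congr hhg
  have hgi : Integrable (fun x => g x * φ x) volume := hi.congr (by
    filter_upwards [hhg] with x hx
    rw [hx])
  have hgiY : ∀ Y : C.lattice, Integrable (fun x => g x * φ (Y +ᵥ x)) volume := by
    intro Y
    have := (measurePreserving_vadd Y (volume : Measure (Space d))).integrable_comp_of_integrable hgi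
    simpa only [Function.comp_def, hg] using this
  have e1 : ∫ x, h x * φ x = ∫ x, g x * φ x := integral_congr_ae (by
    filter_upwards [hhg] with x hx
    rw [hx])
  have e2 : ∫ t, h (C.cellMap t) * periodization C φ (C.cellMap t) =
      ∫ t, g (C.cellMap t) * ∑ Y ∈ Z, φ (Y +ᵥ C.cellMap t) := integral_congr_ae (by
    filter_upwards [hZ, C.quasiMeasurePreserving_cellMap.ae hhg] with t h1 h2
    rw [h1, h2])
  have hsm : AEStronglyMeasurable (fun x => g x * ∑ Y ∈ Z, φ (Y +ᵥ x)) volume :=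
    hgm.mul (Continuous.aestronglyMeasurable
      (continuous_finsetSum _ fun Y _ => hφ.comp (continuous_vadd_lattice C Y)))
  -- The integral over `ℝ^d` is cut into translates of the box, each moved back to the box; `g` is
  -- invariant, so only `φ` sees the translation.
  rw [e1, e2, C.integral_cellMap hsm, smul_smul, mul_inv_cancel₀, one_smul,
    hF.integral_eq_tsum'' _ hgi, tsum_eq_sum (s := Z)]
  · simp only [hg, Finset.mul_sum]
    rw [integral_finsetSum _ fun Y _ => (hgiY Y).integrableOn]
  · intro Y hY
    refine setIntegral_eq_zero_of_forall_eq_zero fun x hx => ?_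
    rw [h0 Y hY x hx, mul_zero]
  · exact ENNReal.toReal_ne_zero.2 ⟨C.volume_box_ne_zero, C.volume_box_ne_top⟩

lemma integrable_ofReal_mul {C : UnitCell d} {f : Space d →ₘ[volume] ℝ} (hf : f ∈ L2per C)
    {φ : Space d → ℂ} (hφ : Continuous φ) (hc : HasCompactSupport φ) :
    Integrable (fun x => ((f x : ℝ) : ℂ) * φ x) volume := by
  have hl : LocallyIntegrable f volume := by
    rw [locallyIntegrable_iff]
    intro K hK
    have : IsFiniteMeasure (volume.restrict K) := ⟨by simpa using hK.measure_lt_top⟩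
    exact (hf.1 K hK).integrable (by norm_num)
  have hl' : LocallyIntegrable (fun x => ((f x : ℝ) : ℂ)) volume := fun x => by
    obtain ⟨s, hs, hi⟩ := hl x
    exact ⟨s, hs, hi.ofReal⟩
  simpa [mul_comm] using hl'.integrable_smul_left_of_hasCompactSupport hφ hc

lemma integral_mul_eq_torus {C : UnitCell d} (f : L2per C)
    {φ : Space d → ℂ} (hφ : Continuous φ) (hc : HasCompactSupport φ) :
    ∫ x, ((f.1 x : ℝ) : ℂ) * φ x = volume.real C.box •
      ∫ t, ((f.1 (C.cellMap t) : ℝ) : ℂ) * periodization C φ (C.cellMap t) := by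
  obtain ⟨g, hfg, hg⟩ := exists_periodic_rep f.2
  refine integral_mul_eq_integral_periodization C (h := fun x => ((f.1 x : ℝ) : ℂ))
    (g := fun x => (g x : ℂ))
    (Complex.continuous_ofReal.comp_aestronglyMeasurable f.1.aestronglyMeasurable) ?_
    (fun Y x => by rw [hg]) hφ hc (integrable_ofReal_mul f.2 hφ hc)
  filter_upwards [hfg] with x hx
  rw [hx]

/-- A distributional identity against `φ` thus becomes an identity in the Hilbert space `TorusL2 d`.
The inner product conjugates its first argument, which is harmless because `f` is real. -/
lemma integral_mul_eq_inner {C : UnitCell d} (f : L2per C)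
    {φ : Space d → ℂ} (hφ : Continuous φ) (hc : HasCompactSupport φ) :
    ∫ x, ((f.1 x : ℝ) : ℂ) * φ x =
      volume.real C.box • inner ℂ (cellLp C f) (perLp C hφ hc) := by
  rw [integral_mul_eq_torus f hφ hc, L2.inner_def]
  congr 1
  refine integral_congr_ae ?_
  filter_upwards [coeFn_cellLp f, coeFn_perLp C hφ hc] with t h1 h2
  simp [h1, h2, mul_comm]

/-! ### Exponentials and Fourier coefficients -/

/-- The exponential of frequency `k` on `ℝ^d`. -/
def UnitCell.expo (C : UnitCell d) (k : Fin d → ℤ) (x : Space d) : ℂ :=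
  UnitAddTorus.mFourier k (C.toTorus x)

/-- The wave vector of frequency `k`. -/
def UnitCell.wave (C : UnitCell d) (k : Fin d → ℤ) (j : Fin d) : ℝ :=
  2 * Real.pi * ∑ l, (k l : ℝ) * C.Y.repr (EuclideanSpace.single j 1) l

/-- The phase of the exponential of frequency `k`. -/
def UnitCell.phase (C : UnitCell d) (k : Fin d → ℤ) : Space d →L[ℝ] ℝ :=
  LinearMap.toContinuousLinearMap ((2 * Real.pi) • ∑ l, (k l : ℝ) • C.Y.coord l)

lemma UnitCell.phase_apply (C : UnitCell d) (k : Fin d → ℤ) (x : Space d) :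
    C.phase k x = 2 * Real.pi * ∑ l, (k l : ℝ) * C.Y.repr x l := by
  simp [UnitCell.phase]

lemma UnitCell.phase_single (C : UnitCell d) (k : Fin d → ℤ) (j : Fin d) :
    C.phase k (EuclideanSpace.single j 1) = C.wave k j := C.phase_apply k _

lemma UnitCell.expo_eq (C : UnitCell d) (k : Fin d → ℤ) (x : Space d) :
    C.expo k x = Complex.exp (Complex.I * (C.phase k x : ℝ)) := by
  simp only [UnitCell.expo, UnitCell.toTorus, UnitAddTorus.mFourier, ContinuousMap.coe_mk,
    fourier_coe_apply]
  rw [← Complex.exp_sum, C.phase_apply]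
  congr 1
  push_cast
  rw [Finset.mul_sum, Finset.mul_sum]
  exact Finset.sum_congr rfl fun l _ => by ring

lemma UnitCell.expo_vadd (C : UnitCell d) (k : Fin d → ℤ) (Y : C.lattice) (x : Space d) :
    C.expo k (Y +ᵥ x) = C.expo k x := by
  rw [UnitCell.expo, C.toTorus_vadd, UnitCell.expo]

lemma UnitCell.contDiff_expo (C : UnitCell d) (k : Fin d → ℤ) : ContDiff ℝ ∞ (C.expo k) := by
  have : C.expo k = fun x => Complex.exp (Complex.I * (C.phase k x : ℝ)) := funext (C.expo_eq k)
  rw [this]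
  exact (contDiff_const.mul (Complex.ofRealCLM.contDiff.comp (C.phase k).contDiff)).cexp

lemma UnitCell.fderiv_expo (C : UnitCell d) (k : Fin d → ℤ) (j : Fin d) (x : Space d) :
    fderiv ℝ (C.expo k) x (EuclideanSpace.single j 1) =
      Complex.I * (C.wave k j : ℝ) * C.expo k x := by
  have : C.expo k = fun x => Complex.exp (Complex.I * (C.phase k x : ℝ)) := funext (C.expo_eq k)
  have h1 : HasFDerivAt (fun x => ((C.phase k x : ℝ) : ℂ))
      (Complex.ofRealCLM.comp (C.phase k)) x :=
    Complex.ofRealCLM.hasFDerivAt.comp x (C.phase k).hasFDerivAt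
  rw [this, ((h1.const_mul Complex.I).cexp).fderiv]
  simp only [smul_apply, ContinuousLinearMap.comp_apply, smul_eq_mul,
    Complex.ofRealCLM_apply, C.phase_single]
  ring

lemma UnitCell.expo_neg (C : UnitCell d) (k : Fin d → ℤ) (x : Space d) :
    C.expo (-k) x = (starRingEnd ℂ) (C.expo k x) := UnitAddTorus.mFourier_neg

lemma UnitCell.wave_neg (C : UnitCell d) (k : Fin d → ℤ) (j : Fin d) :
    C.wave (-k) j = - C.wave k j := by
  simp [UnitCell.wave]

/-- The Fourier coefficient of frequency `k`. -/
def coeff (k : Fin d → ℤ) : TorusL2 d →L[ℂ] ℂ := innerSL ℂ (UnitAddTorus.mFourierLp 2 k)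

lemma hasSum_coeff (u v : TorusL2 d) :
    HasSum (fun k => (starRingEnd ℂ) (coeff k u) * coeff k v) (inner ℂ u v) := by
  have := UnitAddTorus.mFourierBasis.hasSum_inner_mul_inner u v
  simpa [UnitAddTorus.coe_mFourierBasis, coeff, inner_conj_symm] using this

lemma eq_of_coeff {u v : TorusL2 d} (h : ∀ k, coeff k u = coeff k v) : u = v := by
  refine UnitAddTorus.mFourierBasis.repr.injective (lp.ext (funext fun k => ?_))
  simpa [HilbertBasis.repr_apply_apply, coeff] using h k

lemma coeff_mFourierLp (k m : Fin d → ℤ) :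
    coeff m (UnitAddTorus.mFourierLp 2 k) = if m = k then 1 else 0 :=
  (orthonormal_iff_ite.1 UnitAddTorus.orthonormal_mFourier) m k

/-! ### Complex test functions and weak derivatives in Fourier space -/

/-- Smooth compactly supported complex functions. -/
structure IsComplexTest (φ : Space d → ℂ) : Prop where
  contDiff : ContDiff ℝ ∞ φ
  hasCompactSupport : HasCompactSupport φ

/-- The partial derivative of a complex function. -/
def complexPartial (j : Fin d) (φ : Space d → ℂ) (x : Space d) : ℂ :=
  fderiv ℝ φ x (EuclideanSpace.single j 1)

namespace IsComplexTest

variable {φ : Space d → ℂ} (hφ : IsComplexTest φ)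
include hφ

lemma continuous : Continuous φ := hφ.contDiff.continuous

lemma continuous_partial (j : Fin d) : Continuous (complexPartial j φ) :=
  (hφ.contDiff.continuous_fderiv (by simp)).clm_apply continuous_const

lemma hasCompactSupport_partial (j : Fin d) : HasCompactSupport (complexPartial j φ) :=
  hφ.hasCompactSupport.fderiv_apply (𝕜 := ℝ) _

lemma differentiable : Differentiable ℝ φ := hφ.contDiff.differentiable (by simp)

lemma re : IsTest fun x => (φ x).re :=
  ⟨Complex.reCLM.contDiff.comp hφ.contDiff, hφ.hasCompactSupport.comp_left Complex.zero_re⟩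

lemma im : IsTest fun x => (φ x).im :=
  ⟨Complex.imCLM.contDiff.comp hφ.contDiff, hφ.hasCompactSupport.comp_left Complex.zero_im⟩

lemma partial_re (j : Fin d) (x : Space d) :
    partialDeriv j (fun x => (φ x).re) x = (complexPartial j φ x).re := by
  have := (Complex.reCLM.hasFDerivAt.comp x (hφ.differentiable x).hasFDerivAt).fderiv
  rw [partialDeriv]
  exact congrArg (· (EuclideanSpace.single j 1)) this

lemma partial_im (j : Fin d) (x : Space d) :
    partialDeriv j (fun x => (φ x).im) x = (complexPartial j φ x).im := by
  have := (Complex.imCLM.hasFDerivAt.comp x (hφ.differentiable x).hasFDerivAt).fderiv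
  rw [partialDeriv]
  exact congrArg (· (EuclideanSpace.single j 1)) this

end IsComplexTest

lemma IsTest.isComplexTest {φ : Space d → ℝ} (hφ : IsTest φ) :
    IsComplexTest fun x => (φ x : ℂ) :=
  ⟨Complex.ofRealCLM.contDiff.comp hφ.1, hφ.2.comp_left Complex.ofReal_zero⟩

lemma IsTest.complexPartial_ofReal {φ : Space d → ℝ} (hφ : IsTest φ) (j : Fin d) (x : Space d) :
    complexPartial j (fun x => (φ x : ℂ)) x = (partialDeriv j φ x : ℝ) := by
  have := (Complex.ofRealCLM.hasFDerivAt.comp x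
    ((hφ.1.differentiable (by simp)) x).hasFDerivAt).fderiv
  rw [complexPartial]
  exact congrArg (· (EuclideanSpace.single j 1)) this

/-- Splitting of the integral of a real periodic function against a complex one. -/
lemma integral_ofReal_mul_split {C : UnitCell d} (f : L2per C) {φ : Space d → ℂ}
    (hφ : Continuous φ) (hc : HasCompactSupport φ) :
    ∫ x, ((f.1 x : ℝ) : ℂ) * φ x =
      ((∫ x, f.1 x * (φ x).re : ℝ) : ℂ) + Complex.I * ((∫ x, f.1 x * (φ x).im : ℝ) : ℂ) := by
  have hi := integrable_ofReal_mul f.2 hφ hc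
  apply Complex.ext
  · have := (integral_re hi).symm
    simp only [RCLike.re_to_complex, Complex.re_ofReal_mul] at this
    simpa using this
  · have := (integral_im hi).symm
    simp only [RCLike.im_to_complex, Complex.im_ofReal_mul] at this
    simpa using this

/-- Fourier coefficients of a periodization. -/
lemma coeff_perLp (C : UnitCell d) {φ : Space d → ℂ} (hφ : Continuous φ)
    (hc : HasCompactSupport φ) (k : Fin d → ℤ) :
    volume.real C.box • coeff k (perLp C hφ hc) = ∫ x, C.expo (-k) x * φ x := by
  have hcont : Continuous (C.expo (-k)) := (C.contDiff_expo _).continuous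
  rw [integral_mul_eq_integral_periodization C hcont.aestronglyMeasurable EventuallyEq.rfl
    (C.expo_vadd _) hφ hc]
  · congr 1
    change inner ℂ (UnitAddTorus.mFourierLp 2 k) (perLp C hφ hc) = _
    rw [L2.inner_def]
    refine integral_congr_ae ?_
    filter_upwards [UnitAddTorus.coeFn_mFourierLp 2 k, coeFn_perLp C hφ hc] with t h1 h2
    rw [h1, h2, C.expo_neg, UnitCell.expo, C.toTorus_cellMap]
    simp [mul_comm]
  · exact (hcont.mul hφ).integrable_of_hasCompactSupport hc.mul_left

/-- Differentiation multiplies the Fourier coefficients by the wave vector. -/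
lemma coeff_perLp_partial (C : UnitCell d) {φ : Space d → ℂ} (hφ : IsComplexTest φ) (j : Fin d)
    (k : Fin d → ℤ) :
    coeff k (perLp C (hφ.continuous_partial j) (hφ.hasCompactSupport_partial j)) =
      Complex.I * (C.wave k j : ℝ) * coeff k (perLp C hφ.continuous hφ.hasCompactSupport) := by
  have hb : volume.real C.box ≠ 0 :=
    ENNReal.toReal_ne_zero.2 ⟨C.volume_box_ne_zero, C.volume_box_ne_top⟩
  have hcont : Continuous (C.expo (-k)) := (C.contDiff_expo _).continuous
  have h1 : ∫ x, C.expo (-k) x * complexPartial j φ x =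
      Complex.I * (C.wave k j : ℝ) * ∫ x, C.expo (-k) x * φ x := by
    have hi : Integrable (fun x => C.expo (-k) x * φ x) volume :=
      (hcont.mul hφ.continuous).integrable_of_hasCompactSupport hφ.hasCompactSupport.mul_left
    -- Integration by parts: its minus sign cancels the one in the derivative of the exponential of
    -- frequency `-k`.
    have := integral_mul_fderiv_eq_neg_fderiv_mul_of_integrable (μ := volume)
      (f := C.expo (-k)) (g := φ) (v := EuclideanSpace.single j 1) ?_ ?_ hi
      (fun x _ => (C.contDiff_expo _).differentiable (by simp) x)
      (fun x _ => hφ.differentiable x)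
    · simp only [complexPartial]
      rw [this, ← integral_const_mul, ← integral_neg]
      refine integral_congr_ae (Eventually.of_forall fun x => ?_)
      simp only [C.fderiv_expo, C.wave_neg]
      push_cast
      ring
    · simp only [C.fderiv_expo, mul_assoc]
      exact (hi.const_mul _).const_mul _
    · exact (hcont.mul (hφ.continuous_partial j)).integrable_of_hasCompactSupport
        (hφ.hasCompactSupport_partial j).mul_left
  rw [← coeff_perLp C (hφ.continuous_partial j) (hφ.hasCompactSupport_partial j),
    ← coeff_perLp C hφ.continuous hφ.hasCompactSupport, Complex.real_smul, Complex.real_smul] at h1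
  refine mul_left_cancel₀ (Complex.ofReal_ne_zero.2 hb) (h1.trans ?_)
  ring

/-- A smooth compactly supported function whose lattice translates sum up to one. -/
lemma exists_partition (C : UnitCell d) :
    ∃ χ : Space d → ℂ, IsComplexTest χ ∧ ∀ x, periodization C χ x = 1 := by
  obtain ⟨R, hR⟩ := (ZSpan.fundamentalDomain_isBounded C.Y).subset_closedBall (0 : Space d)
  -- The bump equals one on a ball containing the box, so every point has a translate where it
  -- equals one and its periodization vanishes nowhere. The maximum with `1` keeps the inner radius
  -- positive when `R` is not.
  let b : ContDiffBump (0 : Space d) := ⟨max R 1, max R 1 + 1, by positivity, by linarith⟩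
  let η : Space d → ℂ := fun x => ((b x : ℝ) : ℂ)
  have hη : IsComplexTest η := IsTest.isComplexTest ⟨b.contDiff, b.hasCompactSupport⟩
  have hsmooth : ContDiff ℝ ∞ (periodization C η) := by
    refine contDiff_iff_contDiffAt.2 fun x => ?_
    obtain ⟨Z, -, hZ⟩ := exists_finset_periodization C hη.hasCompactSupport
      (Metric.isBounded_ball (x := x) (r := 1))
    have h1 : ContDiff ℝ ∞ fun y => ∑ Y ∈ Z, η (Y +ᵥ y) :=
      ContDiff.sum fun Y _ => hη.contDiff.comp (contDiff_const.add contDiff_id)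
    refine h1.contDiffAt.congr_of_eventuallyEq ?_
    filter_upwards [Metric.ball_mem_nhds x one_pos] with y hy
    exact hZ y hy
  have hne : ∀ x, periodization C η x ≠ 0 := by
    intro x
    obtain ⟨Y, hY, -⟩ := ZSpan.exist_unique_vadd_mem_fundamentalDomain C.Y x
    rw [← periodization_vadd C η Y x]
    obtain ⟨Z, h0, hZ⟩ := exists_finset_periodization C hη.hasCompactSupport
      (ZSpan.fundamentalDomain_isBounded C.Y)
    rw [hZ _ hY]
    have hb1 : b (Y +ᵥ x) = 1 := b.one_of_mem_closedBall
      (Metric.closedBall_subset_closedBall (le_max_left R 1) (hR hY))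
    have h0mem : (0 : C.lattice) ∈ Z := by
      by_contra h
      have := h0 0 h _ hY
      simp [η, hb1] at this
    have hpos : 0 < ∑ W ∈ Z, b (W +ᵥ (Y +ᵥ x)) :=
      Finset.sum_pos' (fun W _ => b.nonneg) ⟨0, h0mem, by rw [zero_vadd, hb1]; exact one_pos⟩
    have : (∑ W ∈ Z, η (W +ᵥ (Y +ᵥ x))) = ((∑ W ∈ Z, b (W +ᵥ (Y +ᵥ x)) : ℝ) : ℂ) := by
      push_cast
      rfl
    rw [this]
    exact Complex.ofReal_ne_zero.2 hpos.ne'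
  -- The normalizing factor is lattice-invariant, hence comes out of the sum over translates.
  refine ⟨fun x => η x * (periodization C η x)⁻¹,
    ⟨hη.contDiff.mul (hsmooth.inv hne), hη.hasCompactSupport.mul_right⟩, fun x => ?_⟩
  rw [periodization]
  simp only [periodization_vadd]
  rw [tsum_mul_right]
  exact mul_inv_cancel₀ (hne x)

/-- Every exponential is the periodization of a test function. -/
lemma exists_test_expo (C : UnitCell d) (k : Fin d → ℤ) :
    ∃ φ : Space d → ℂ, ∃ hφ : IsComplexTest φ,
      perLp C hφ.continuous hφ.hasCompactSupport = UnitAddTorus.mFourierLp 2 k ∧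
      ∀ j, perLp C (hφ.continuous_partial j) (hφ.hasCompactSupport_partial j) =
        (Complex.I * (C.wave k j : ℝ)) • UnitAddTorus.mFourierLp 2 k := by
  obtain ⟨χ, hχ, h1⟩ := exists_partition C
  -- The exponential is lattice-invariant, so periodizing this product gives the exponential times
  -- the periodization of `χ`, which is one.
  have hφ : IsComplexTest fun x => χ x * C.expo k x :=
    ⟨hχ.contDiff.mul (C.contDiff_expo k), hχ.hasCompactSupport.mul_right⟩
  have h2 : perLp C hφ.continuous hφ.hasCompactSupport = UnitAddTorus.mFourierLp 2 k := by
    refine Lp.ext ?_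
    filter_upwards [UnitAddTorus.coeFn_mFourierLp 2 k,
      coeFn_perLp C hφ.continuous hφ.hasCompactSupport] with t h3 h4
    rw [h3, h4, periodization]
    simp only [C.expo_vadd]
    rw [tsum_mul_right]
    have := h1 (C.cellMap t)
    rw [periodization] at this
    rw [this, one_mul, UnitCell.expo, C.toTorus_cellMap]
  -- Comparing Fourier coefficients through `coeff_perLp_partial` avoids differentiating the
  -- periodization.
  refine ⟨_, hφ, h2, fun j => eq_of_coeff fun m => ?_⟩
  rw [coeff_perLp_partial C hφ, h2, map_smul, coeff_mFourierLp, smul_eq_mul]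
  split_ifs with h
  · rw [h]
  · simp

lemma UnitCell.volume_real_box_pos (C : UnitCell d) : 0 < volume.real C.box :=
  ENNReal.toReal_pos C.volume_box_ne_zero C.volume_box_ne_top

lemma inner_mFourierLp (u : TorusL2 d) (k : Fin d → ℤ) :
    inner ℂ u (UnitAddTorus.mFourierLp 2 k) = (starRingEnd ℂ) (coeff k u) :=
  (inner_conj_symm _ _).symm

/-- Weak differentiation multiplies the Fourier coefficients by the wave vector. -/
lemma IsWeakPartial.coeff_eq {C : UnitCell d} {j : Fin d} {f g : L2per C}
    (h : IsWeakPartial j f.1 g.1) (k : Fin d → ℤ) :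
    coeff k (cellLp C g) = Complex.I * (C.wave k j : ℝ) * coeff k (cellLp C f) := by
  -- Testing against a function that periodizes to the exponential of frequency `k` isolates the
  -- coefficient at `k`, up to conjugation since the exponential sits on the right of the inner
  -- product.
  obtain ⟨φ, hφ, h1, h2⟩ := exists_test_expo C k
  have h3 : ∫ x, ((f.1 x : ℝ) : ℂ) * complexPartial j φ x = - ∫ x, ((g.1 x : ℝ) : ℂ) * φ x := by
    rw [integral_ofReal_mul_split f (hφ.continuous_partial j) (hφ.hasCompactSupport_partial j),
      integral_ofReal_mul_split g hφ.continuous hφ.hasCompactSupport]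
    simp only [← hφ.partial_re, ← hφ.partial_im]
    rw [h _ hφ.re, h _ hφ.im]
    push_cast
    ring
  rw [integral_mul_eq_inner f (hφ.continuous_partial j) (hφ.hasCompactSupport_partial j),
    integral_mul_eq_inner g hφ.continuous hφ.hasCompactSupport, h1, h2, inner_smul_right,
    ← smul_neg] at h3
  have h4 := smul_right_injective ℂ C.volume_real_box_pos.ne' h3
  rw [inner_mFourierLp, inner_mFourierLp] at h4
  have h5 := congrArg (starRingEnd ℂ) h4
  simp only [map_mul, map_neg, Complex.conj_I, Complex.conj_ofReal, Complex.conj_conj] at h5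
  linear_combination h5

/-- By Parseval this is termwise: the multiplier `i κ_j` is purely imaginary, so moving it across
the inner product changes its sign. -/
lemma inner_perLp_partial (C : UnitCell d) {u U : TorusL2 d} {j : Fin d}
    (h : ∀ k, coeff k U = Complex.I * (C.wave k j : ℝ) * coeff k u) {φ : Space d → ℂ}
    (hφ : IsComplexTest φ) :
    inner ℂ u (perLp C (hφ.continuous_partial j) (hφ.hasCompactSupport_partial j)) =
      - inner ℂ U (perLp C hφ.continuous hφ.hasCompactSupport) := by
  refine (hasSum_coeff u _).unique ?_
  convert! (hasSum_coeff U (perLp C hφ.continuous hφ.hasCompactSupport)).neg using 2 with k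
  rw [coeff_perLp_partial C hφ, h]
  simp only [map_mul, Complex.conj_I, Complex.conj_ofReal]
  ring

lemma periodization_ofReal_im (C : UnitCell d) (φ : Space d → ℝ) (x : Space d) :
    (periodization C (fun x => (φ x : ℂ)) x).im = 0 := by
  rw [periodization, ← Complex.ofReal_tsum, Complex.ofReal_im]

/-- The periodization of a real function is real, so taking the real part of `u` amounts to taking
the real part of the inner product. -/
lemma integral_periodicRe_mul (C : UnitCell d) (u : TorusL2 d) {φ : Space d → ℝ}
    (hφ : Continuous fun x => (φ x : ℂ)) (hc : HasCompactSupport fun x => (φ x : ℂ)) :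
    ∫ x, (periodicRe C u).1 x * φ x = volume.real C.box * (inner ℂ u (perLp C hφ hc)).re := by
  have h1 := integral_mul_eq_inner (periodicRe C u) hφ hc
  have h2 : ∫ x, (((periodicRe C u).1 x : ℝ) : ℂ) * (φ x : ℂ) =
      ((∫ x, (periodicRe C u).1 x * φ x : ℝ) : ℂ) := by
    rw [← integral_complex_ofReal]
    simp only [Complex.ofReal_mul]
  rw [h2] at h1
  have h3 := congrArg Complex.re h1
  rw [Complex.ofReal_re, Complex.smul_re, smul_eq_mul] at h3
  rw [h3]
  congr 1
  rw [L2.inner_def, L2.inner_def]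
  have i1 := integral_re (L2.integrable_inner (𝕜 := ℂ) (cellLp C (periodicRe C u)) (perLp C hφ hc))
  have i2 := integral_re (L2.integrable_inner (𝕜 := ℂ) u (perLp C hφ hc))
  simp only [RCLike.re_to_complex] at i1 i2
  rw [← i1, ← i2]
  refine integral_congr_ae ?_
  filter_upwards [coeFn_cellLp (periodicRe C u), coeFn_periodicRe C u, coeFn_perLp C hφ hc]
    with t a b c
  have := periodization_ofReal_im C φ (C.cellMap t)
  simp [a, b, c, this]

/-- A relation between Fourier coefficients implies weak differentiability. -/
lemma isWeakPartial_periodicRe (C : UnitCell d) {u U : TorusL2 d} {j : Fin d}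
    (h : ∀ k, coeff k U = Complex.I * (C.wave k j : ℝ) * coeff k u) :
    IsWeakPartial j (periodicRe C u).1 (periodicRe C U).1 := by
  intro φ hφ
  have hφ' := hφ.isComplexTest
  have hp : (fun x => ((partialDeriv j φ x : ℝ) : ℂ)) = complexPartial j fun x => (φ x : ℂ) :=
    funext fun x => (hφ.complexPartial_ofReal j x).symm
  rw [integral_periodicRe_mul C U hφ'.continuous hφ'.hasCompactSupport,
    integral_periodicRe_mul C u (hp ▸ hφ'.continuous_partial j)
      (hp ▸ hφ'.hasCompactSupport_partial j)]
  have := inner_perLp_partial C h hφ'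
  simp only [hp]
  rw [this, Complex.neg_re, mul_neg]

/-! ### Divergence-free stresses and their duality with compatible strains -/

/-- A stress field is divergence-free in the sense of distributions. -/
def IsDivFree {C : UnitCell d} (s : StressSpace C) : Prop :=
  ∀ φ : Space d → ℝ, IsTest φ → ∀ i, ∑ j, ∫ x, s.1 i j x * partialDeriv j φ x = 0

lemma integral_partialDeriv {φ : Space d → ℝ} (hφ : IsTest φ) (j : Fin d) :
    ∫ x, partialDeriv j φ x = 0 := by
  have hd : Integrable (partialDeriv j φ) volume :=
    (hφ.continuous_partialDeriv j).integrable_of_hasCompactSupport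
      (hφ.hasCompactSupport_partialDeriv j)
  have := integral_mul_fderiv_eq_neg_fderiv_mul_of_integrable (μ := volume)
    (f := fun _ : Space d => (1 : ℝ)) (g := φ) (v := EuclideanSpace.single j 1) (by simp)
    (by simpa using! hd)
    (by simpa using hφ.1.continuous.integrable_of_hasCompactSupport hφ.2)
    (fun x _ => differentiableAt_const _) (fun x _ => hφ.1.differentiable (by simp) x)
  simpa using! this

lemma const_mem_L2per (C : UnitCell d) (a : ℝ) : AEEqFun.const (Space d) a ∈ L2per C := by
  have h0 := AEEqFun.coeFn_const (μ := (volume : Measure (Space d))) (Space d) a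
  refine ⟨fun K hK => (memLp_congr_ae (ae_restrict_of_ae h0)).2 ?_, fun Y _ => ?_⟩
  · have : IsFiniteMeasure (volume.restrict K) := ⟨by simpa using hK.measure_lt_top⟩
    exact memLp_const a
  · filter_upwards [h0, (measurePreserving_add_right volume Y).quasiMeasurePreserving.ae h0]
      with x h1 h2
    rw [h1, h2]
    rfl

lemma isDivFree_of_mem_uniformFields {C : UnitCell d} {s : StressSpace C}
    (hs : s ∈ uniformFields C) : IsDivFree s := by
  obtain ⟨a, ha⟩ := hs
  refine fun φ hφ i => Finset.sum_eq_zero fun j _ => ?_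
  have : ∫ x, s.1 i j x * partialDeriv j φ x = ∫ x, a i j * partialDeriv j φ x := by
    refine integral_congr_ae ?_
    rw [ha]
    filter_upwards [AEEqFun.coeFn_const (μ := (volume : Measure (Space d))) (Space d) (a i j)]
      with x hx
    rw [hx]
    rfl
  rw [this, integral_const_mul, integral_partialDeriv hφ, mul_zero]

lemma IsDivFree.add {C : UnitCell d} {s t : StressSpace C} (hs : IsDivFree s)
    (ht : IsDivFree t) : IsDivFree (s + t) := by
  intro φ hφ i
  have := congrArg₂ (· + ·) (hs φ hφ i) (ht φ hφ i)
  simp only [add_zero, ← Finset.sum_add_distrib] at this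
  rw [← this]
  exact Finset.sum_congr rfl fun j _ => integral_add_mul_test (s.2.2 i j) (t.2.2 i j)
    (hφ.continuous_partialDeriv j) (hφ.hasCompactSupport_partialDeriv j)

lemma isFiniteMeasure_cell (C : UnitCell d) : IsFiniteMeasure (volume.restrict C.V) := by
  refine ⟨?_⟩
  rw [Measure.restrict_apply_univ, lt_top_iff_ne_top]
  intro h
  exact volume_cell_ne_zero C (by rw [measureReal_def, h, ENNReal.toReal_top])

/-- Statically admissible stress fields are the divergence-free ones. -/
lemma mem_S_iff {C : UnitCell d} (s : StressSpace C) : s ∈ S C ↔ IsDivFree s := by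
  refine ⟨fun h => ?_, fun h => ?_⟩
  · obtain ⟨a, ha, b, hb, rfl⟩ := Submodule.mem_sup.1 h
    exact (isDivFree_of_mem_uniformFields ha).add hb.1
  · let m : TensorField C := ⟨fun i j => AEEqFun.const (Space d) (⨍ x in C.V, s.1 i j x),
      fun i j => congrArg (fun f : Space d →ₘ[volume] ℝ =>
        AEEqFun.const (Space d) (⨍ x in C.V, f x)) (s.2.1 i j), fun i j => const_mem_L2per C _⟩
    have hm : m ∈ uniformFields C := ⟨fun i j => ⨍ x in C.V, s.1 i j x, fun i j => rfl⟩
    have hms : s + (-1 : ℝ) • m ∈ S0 C := by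
      refine ⟨h.add (isDivFree_of_mem_uniformFields ((uniformFields C).smul_mem _ hm)),
        fun i j => ?_⟩
      have hfin := isFiniteMeasure_cell C
      have h1 : ∀ᵐ x, (s + (-1 : ℝ) • m).1 i j x = s.1 i j x - ⨍ x in C.V, s.1 i j x := by
        filter_upwards [AEEqFun.coeFn_add (s.1 i j) (((-1 : ℝ) • m).1 i j),
          AEEqFun.coeFn_smul (-1 : ℝ) (m.1 i j),
          AEEqFun.coeFn_const (μ := (volume : Measure (Space d))) (Space d)
            (⨍ x in C.V, s.1 i j x)] with x a b c
        have b' : ((-1 : ℝ) • m).1 i j x = (-1 : ℝ) * m.1 i j x := b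
        have c' : m.1 i j x = ⨍ x in C.V, s.1 i j x := c
        refine a.trans ?_
        rw [Pi.add_apply, b', c']
        ring
      rw [setAverage_eq, integral_congr_ae (ae_restrict_of_ae h1),
        integral_sub ((memLp_cell (s.2.2 i j)).integrable (by norm_num)) (integrable_const _),
        integral_const, setAverage_eq, measureReal_restrict_apply_univ, smul_smul,
        mul_inv_cancel₀ (volume_cell_ne_zero C), one_smul, sub_self, smul_zero]
    have : s = m + (s + (-1 : ℝ) • m) := by
      module
    rw [this]
    exact Submodule.add_mem_sup hm hms

/-- The divergence is tested against the real and imaginary parts of a function that periodizes to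
the exponential of frequency `k`. -/
lemma IsDivFree.coeff_eq_zero {C : UnitCell d} {s : StressSpace C} (hs : IsDivFree s)
    (i : Fin d) (k : Fin d → ℤ) :
    ∑ j, (C.wave k j : ℂ) * coeff k (comp C i j s) = 0 := by
  obtain ⟨φ, hφ, h1, h2⟩ := exists_test_expo C k
  have h3 : ∑ j, ∫ x, ((s.1 i j x : ℝ) : ℂ) * complexPartial j φ x = 0 := by
    have : ∀ j, ∫ x, ((s.1 i j x : ℝ) : ℂ) * complexPartial j φ x =
        ((∫ x, s.1 i j x * partialDeriv j (fun x => (φ x).re) x : ℝ) : ℂ) +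
        Complex.I * ((∫ x, s.1 i j x * partialDeriv j (fun x => (φ x).im) x : ℝ) : ℂ) := by
      intro j
      have := integral_ofReal_mul_split ⟨s.1 i j, s.2.2 i j⟩
        (hφ.continuous_partial j) (hφ.hasCompactSupport_partial j)
      simpa only [hφ.partial_re, hφ.partial_im] using this
    simp only [this, Finset.sum_add_distrib, ← Finset.mul_sum, ← Complex.ofReal_sum]
    rw [hs _ hφ.re, hs _ hφ.im]
    simp
  have h4 : ∀ j, ∫ x, ((s.1 i j x : ℝ) : ℂ) * complexPartial j φ x =
      volume.real C.box * (Complex.I * ((C.wave k j : ℂ) *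
        (starRingEnd ℂ) (coeff k (comp C i j s)))) := by
    intro j
    have := integral_mul_eq_inner ⟨s.1 i j, s.2.2 i j⟩ (hφ.continuous_partial j)
      (hφ.hasCompactSupport_partial j)
    rw [h2, inner_smul_right, inner_mFourierLp, Complex.real_smul, mul_assoc Complex.I] at this
    exact this
  simp only [h4, ← Finset.mul_sum] at h3
  have h5 := (mul_eq_zero.1 ((mul_eq_zero.1 h3).resolve_left
    (Complex.ofReal_ne_zero.2 C.volume_real_box_pos.ne'))).resolve_left Complex.I_ne_zero
  have h6 := congrArg (starRingEnd ℂ) h5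
  simpa using h6

lemma comp_eq_of_field {C : UnitCell d} {η : TensorField C} {i j : Fin d} {f g : L2per C}
    (h : η.1 i j = (1 / 2 : ℝ) • (f.1 + g.1)) :
    comp C i j η = (1 / 2 : ℝ) • (cellLp C f + cellLp C g) := by
  rw [← map_add, ← map_smul]
  exact congrArg (cellLp C) (Subtype.ext h)

lemma coeff_real_smul (k : Fin d → ℤ) (r : ℝ) (u : TorusL2 d) :
    coeff k (r • u) = (r : ℂ) * coeff k u := by
  have : r • u = (r : ℂ) • u := (Complex.coe_smul r u).symm
  rw [this, map_smul, smul_eq_mul]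

/-- The strain field of a periodic displacement in Fourier space. -/
lemma exists_coeff_of_mem_E0 {C : UnitCell d} {L₀ : Stiffness d} {e : StrainSpace C L₀}
    (he : e ∈ E0 C L₀) (k : Fin d → ℤ) : ∃ a : Fin d → ℂ, ∀ i j,
      coeff k (comp C i j e.field) =
        Complex.I / 2 * ((C.wave k j : ℂ) * a i + (C.wave k i : ℂ) * a j) := by
  obtain ⟨w, G, h, hG⟩ := he
  refine ⟨fun i => coeff k (cellLp C ⟨w i, h.mem i⟩), fun i j => ?_⟩
  rw [comp_eq_of_field (f := ⟨G i j, h.grad_mem i j⟩) (g := ⟨G j i, h.grad_mem j i⟩) (hG i j),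
    coeff_real_smul, map_add,
    IsWeakPartial.coeff_eq (f := ⟨w i, h.mem i⟩) (g := ⟨G i j, h.grad_mem i j⟩) (h.grad i j),
    IsWeakPartial.coeff_eq (f := ⟨w j, h.mem j⟩) (g := ⟨G j i, h.grad_mem j i⟩) (h.grad j i)]
  push_cast
  ring

/-- Statically admissible stress fields do no work in compatible strain fields. -/
lemma pairing_eq_zero_of_mem {C : UnitCell d} {L₀ : Stiffness d} {s : StressSpace C}
    (hs : s ∈ S C) {e : StrainSpace C L₀} (he : e ∈ E0 C L₀) : pairing s e.field = 0 := by
  have hd := ((mem_S_iff s).1 hs).coeff_eq_zero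
  have h0 : ∑ i, ∑ j, inner ℂ (comp C i j s) (comp C i j e.field) = 0 := by
    have hsum : HasSum (fun k => ∑ i, ∑ j, (starRingEnd ℂ) (coeff k (comp C i j s)) *
        coeff k (comp C i j e.field))
        (∑ i, ∑ j, inner ℂ (comp C i j s) (comp C i j e.field)) :=
      hasSum_sum fun i _ => hasSum_sum fun j _ => hasSum_coeff _ _
    refine hsum.unique ?_
    -- Each frequency contributes zero on its own: the stress coefficient annihilates `κ`, and the
    -- strain coefficient is built from symmetrized products with `κ`.
    convert! hasSum_zero using 2 with k
    obtain ⟨a, ha⟩ := exists_coeff_of_mem_E0 he k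
    have h1 : ∀ i, ∑ j, (starRingEnd ℂ) (coeff k (comp C i j s)) * (C.wave k j : ℂ) = 0 := by
      intro i
      have := congrArg (starRingEnd ℂ) (hd i k)
      simpa [mul_comm] using this
    have h2 : ∑ i, ∑ j, (starRingEnd ℂ) (coeff k (comp C i j s)) *
        ((C.wave k j : ℂ) * a i) = 0 := by
      refine Finset.sum_eq_zero fun i _ => ?_
      simp only [← mul_assoc]
      rw [← Finset.sum_mul, h1, zero_mul]
    -- The symmetry of the stress exchanges the two halves of the symmetrized product.
    have h3 : ∑ i, ∑ j, (starRingEnd ℂ) (coeff k (comp C i j s)) *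
        ((C.wave k i : ℂ) * a j) = 0 := by
      rw [Finset.sum_comm, ← h2]
      refine Finset.sum_congr rfl fun i _ => Finset.sum_congr rfl fun j _ => ?_
      rw [comp_symm]
    have h4 : ∀ i j, (starRingEnd ℂ) (coeff k (comp C i j s)) * coeff k (comp C i j e.field) =
        Complex.I / 2 * ((starRingEnd ℂ) (coeff k (comp C i j s)) * ((C.wave k j : ℂ) * a i)) +
        Complex.I / 2 * ((starRingEnd ℂ) (coeff k (comp C i j s)) * ((C.wave k i : ℂ) * a j)) := by
      intro i j
      rw [ha]
      ring
    simp only [h4, Finset.sum_add_distrib, ← Finset.mul_sum]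
    rw [h2, h3]
    simp
  rw [pairing_eq_inner]
  have := congrArg Complex.re h0
  simpa only [Complex.re_sum, Complex.zero_re] using this

lemma inner_real_smul_right (u v : TorusL2 d) (r : ℝ) :
    (inner ℂ u (r • v)).re = r * (inner ℂ u v).re := by
  have : r • v = (r : ℂ) • v := (Complex.coe_smul r v).symm
  rw [this, inner_smul_right, Complex.re_ofReal_mul]

lemma perLp_ofReal_im (C : UnitCell d) {φ : Space d → ℝ} (hφ : Continuous fun x => (φ x : ℂ))
    (hc : HasCompactSupport fun x => (φ x : ℂ)) : ∀ᵐ t, (perLp C hφ hc t).im = 0 := by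
  filter_upwards [coeFn_perLp C hφ hc] with t ht
  rw [ht, periodization_ofReal_im]

lemma cellLp_periodicRe_zero (C : UnitCell d) : cellLp C (periodicRe C 0) = 0 := by
  refine cellLp_periodicRe C ?_
  filter_upwards [Lp.coeFn_zero ℂ 2 (volume : Measure (Torus d))] with t ht
  rw [ht]
  rfl

/-- A stress field that does no work in compatible strain fields is statically admissible. -/
lemma mem_S_of_pairing_eq_zero {C : UnitCell d} (L₀ : Stiffness d) {s : StressSpace C}
    (h : ∀ e ∈ E0 C L₀, pairing s e.field = 0) : s ∈ S C := by
  rw [mem_S_iff]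
  intro φ hφ i₀
  have hφ' := hφ.isComplexTest
  have hp : ∀ j, (fun x => ((partialDeriv j φ x : ℝ) : ℂ)) =
      complexPartial j fun x => (φ x : ℂ) :=
    fun j => funext fun x => (hφ.complexPartial_ofReal j x).symm
  set P := perLp C hφ'.continuous hφ'.hasCompactSupport
  set Q : Fin d → TorusL2 d := fun j =>
    perLp C (hφ'.continuous_partial j) (hφ'.hasCompactSupport_partial j)
  have hQim : ∀ j, ∀ᵐ t, (Q j t).im = 0 := by
    intro j
    have := perLp_ofReal_im C (φ := partialDeriv j φ) (hp j ▸ hφ'.continuous_partial j)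
      (hp j ▸ hφ'.hasCompactSupport_partial j)
    simpa only [hp] using this
  -- The trial displacement is the periodized test function in the direction `i₀`. The work of `s`
  -- in its strain is, up to the volume of the box, row `i₀` of the divergence tested against `φ`.
  let w : Fin d → L2per C := fun i => periodicRe C (if i = i₀ then P else 0)
  let G : Fin d → Fin d → L2per C := fun i j => periodicRe C (if i = i₀ then Q j else 0)
  have hG : ∀ i j, cellLp C (G i j) = if i = i₀ then Q j else 0 := by
    intro i j
    by_cases hi : i = i₀
    · simp only [G, if_pos hi]
      exact cellLp_periodicRe C (hQim j)
    · simp only [G, if_neg hi]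
      exact cellLp_periodicRe_zero C
  have hweak : ∀ i j, IsWeakPartial j (w i).1 (G i j).1 := by
    intro i j
    refine isWeakPartial_periodicRe C fun k => ?_
    by_cases hi : i = i₀
    · simp only [if_pos hi]
      exact coeff_perLp_partial C hφ' j k
    · simp [if_neg hi]
  let e : TensorField C := ⟨fun i j => (1 / 2 : ℝ) • ((G i j).1 + (G j i).1),
    fun i j => congrArg _ (add_comm _ _),
    fun i j => (L2per C).smul_mem _ ((L2per C).add_mem (G i j).2 (G j i).2)⟩
  have he := h e ⟨fun i => (w i).1, fun i j => (G i j).1,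
    ⟨fun i => (w i).2, fun i j => (G i j).2, hweak⟩, fun i j => rfl⟩
  have hcomp : ∀ i j, comp C i j e = (1 / 2 : ℝ) • (cellLp C (G i j) + cellLp C (G j i)) :=
    fun i j => comp_eq_of_field rfl
  have he' : pairing s e = 0 := he
  rw [pairing_eq_inner] at he'
  simp only [hcomp, inner_real_smul_right, inner_add_right, Complex.add_re, mul_add,
    Finset.sum_add_distrib] at he'
  -- As `s` is symmetric, the transposed half of the strain does the same work, which compensates
  -- the factor `1 / 2`.
  have hsymm : ∑ i, ∑ j, 1 / 2 * (inner ℂ (comp C i j s) (cellLp C (G j i))).re =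
      ∑ i, ∑ j, 1 / 2 * (inner ℂ (comp C i j s) (cellLp C (G i j))).re := by
    rw [Finset.sum_comm]
    refine Finset.sum_congr rfl fun i _ => Finset.sum_congr rfl fun j _ => ?_
    rw [comp_symm]
  rw [hsymm] at he'
  have hrow : ∑ i, ∑ j, 1 / 2 * (inner ℂ (comp C i j s) (cellLp C (G i j))).re =
      ∑ j, 1 / 2 * (inner ℂ (comp C i₀ j s) (Q j)).re := by
    rw [Finset.sum_eq_single i₀]
    · simp only [hG, if_pos]
    · intro i _ hi
      simp only [hG, if_neg hi, inner_zero_right, Complex.zero_re, mul_zero, Finset.sum_const_zero]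
    · simp
  rw [hrow, ← Finset.mul_sum] at he'
  have hint : ∀ j, ∫ x, s.1 i₀ j x * partialDeriv j φ x =
      volume.real C.box * (inner ℂ (comp C i₀ j s) (Q j)).re := by
    intro j
    have h1 := integral_mul_eq_inner ⟨s.1 i₀ j, s.2.2 i₀ j⟩ (hφ'.continuous_partial j)
      (hφ'.hasCompactSupport_partial j)
    simp only [← hp, ← Complex.ofReal_mul] at h1
    rw [integral_complex_ofReal] at h1
    have h2 := congrArg Complex.re h1
    rw [Complex.ofReal_re, Complex.smul_re, smul_eq_mul] at h2
    simp only [hp] at h2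
    exact h2
  simp only [hint, ← Finset.mul_sum]
  have : ∑ j, (inner ℂ (comp C i₀ j s) (Q j)).re = 0 := by linarith
  rw [this, mul_zero]

/-! ### Compatibility in Fourier space -/

/-- The Fourier coefficient of the displacement giving rise to the strain coefficient `M`
at the wave vector `κ`. -/
def amplitude (κ : Fin d → ℝ) (M : Fin d → Fin d → ℂ) (i : Fin d) : ℂ :=
  -Complex.I / ((∑ l, κ l ^ 2 : ℝ) : ℂ) * (2 * ∑ l, M i l * κ l -
    κ i / ((∑ l, κ l ^ 2 : ℝ) : ℂ) * ∑ l, κ l * ∑ m, M l m * κ m)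

/-- Compatibility of the strain coefficient `M` at the wave vector `κ`. -/
def IsCompatible (κ : Fin d → ℝ) (M : Fin d → Fin d → ℂ) : Prop :=
  ∀ i j, M i j = Complex.I / 2 * ((κ j : ℂ) * amplitude κ M i + (κ i : ℂ) * amplitude κ M j)

/-- Contracting with `κ` gives `M κ = (i/2) (|κ|² a + (κ·a) κ)`, and contracting again `κ·Mκ = i
|κ|² (κ·a)`. Solving for `a` yields the formula of `amplitude`, so for `κ ≠ 0` the vector `a` is
determined by `M`. For `κ = 0` the coefficient `M` vanishes and the amplitude plays no role. -/
lemma isCompatible_of_exists {κ : Fin d → ℝ} {M : Fin d → Fin d → ℂ} {a : Fin d → ℂ}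
    (h : ∀ i j, M i j = Complex.I / 2 * ((κ j : ℂ) * a i + (κ i : ℂ) * a j)) :
    IsCompatible κ M := by
  by_cases hq : ∑ l, κ l ^ 2 = 0
  · have hκ : ∀ l, κ l = 0 := fun l => by
      have := (Finset.sum_eq_zero_iff_of_nonneg fun l _ => sq_nonneg (κ l)).1 hq l
        (Finset.mem_univ l)
      exact pow_eq_zero_iff two_ne_zero |>.1 this
    intro i j
    rw [h]
    simp [hκ]
  · have hq' : ((∑ l, κ l ^ 2 : ℝ) : ℂ) ≠ 0 := Complex.ofReal_ne_zero.2 hq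
    have hamp : ∀ i, amplitude κ M i = a i := by
      intro i
      set q : ℂ := ((∑ l, κ l ^ 2 : ℝ) : ℂ) with hqdef
      have hqs : ∑ l, (κ l : ℂ) * κ l = q := by
        rw [hqdef]
        push_cast
        exact Finset.sum_congr rfl fun l _ => by ring
      set p : ℂ := ∑ l, (κ l : ℂ) * a l with hp
      have h1 : ∀ i, ∑ l, M i l * κ l = Complex.I / 2 * (q * a i + κ i * p) := by
        intro i
        rw [← hqs, hp, Finset.sum_mul, Finset.mul_sum, ← Finset.sum_add_distrib, Finset.mul_sum]
        refine Finset.sum_congr rfl fun l _ => ?_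
        rw [h]
        ring
      have h2 : ∑ l, (κ l : ℂ) * ∑ m, M l m * κ m = Complex.I * (q * p) := by
        have : ∑ l, (κ l : ℂ) * (Complex.I / 2 * (q * a l + κ l * p)) =
            Complex.I / 2 * (q * ∑ l, (κ l : ℂ) * a l + (∑ l, (κ l : ℂ) * κ l) * p) := by
          rw [Finset.mul_sum, Finset.sum_mul, ← Finset.sum_add_distrib, Finset.mul_sum]
          exact Finset.sum_congr rfl fun l _ => by ring
        simp only [h1]
        rw [this, ← hp, hqs]
        ring
      rw [amplitude, ← hqdef, h1, h2]
      field_simp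
      linear_combination (-q * a i) * Complex.I_sq
    intro i j
    rw [h, hamp, hamp]

/-- The amplitude is homogeneous of degree `-1` in `κ`. The constant is `2 + 1`, one contribution
from each term of its definition; for `κ = 0` the left side is zero. -/
lemma norm_amplitude_mul_le (κ : Fin d → ℝ) (M : Fin d → Fin d → ℂ) (i : Fin d) :
    √(∑ l, κ l ^ 2) * ‖amplitude κ M i‖ ≤ 3 * ∑ l, ∑ m, ‖M l m‖ := by
  set q := ∑ l, κ l ^ 2 with hq
  set r := √q with hr
  set T := ∑ l, ∑ m, ‖M l m‖ with hT
  have hT0 : 0 ≤ T := Finset.sum_nonneg fun l _ => Finset.sum_nonneg fun m _ => norm_nonneg _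
  have hq0 : 0 ≤ q := Finset.sum_nonneg fun l _ => sq_nonneg _
  have hrq : r ^ 2 = q := Real.sq_sqrt hq0
  have hκ : ∀ l, |κ l| ≤ r := fun l =>
    Real.abs_le_sqrt (Finset.single_le_sum (f := fun l => κ l ^ 2) (fun l _ => sq_nonneg _)
      (Finset.mem_univ l))
  rcases (Real.sqrt_nonneg q).eq_or_lt with h0 | hpos
  · rw [hr, ← h0, zero_mul]
    positivity
  have hrpos : 0 < r := hpos
  have h1 : ∀ l, ‖∑ m, M l m * κ m‖ ≤ (∑ m, ‖M l m‖) * r := by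
    intro l
    rw [Finset.sum_mul]
    refine norm_sum_le_of_le _ fun m _ => ?_
    rw [norm_mul, Complex.norm_real, Real.norm_eq_abs]
    exact mul_le_mul_of_nonneg_left (hκ m) (norm_nonneg _)
  have h1' : ‖∑ m, M i m * κ m‖ ≤ T * r := (h1 i).trans <| by
    refine mul_le_mul_of_nonneg_right ?_ hrpos.le
    exact Finset.single_le_sum (f := fun l => ∑ m, ‖M l m‖)
      (fun l _ => Finset.sum_nonneg fun m _ => norm_nonneg _) (Finset.mem_univ i)
  have h2 : ‖∑ l, (κ l : ℂ) * ∑ m, M l m * κ m‖ ≤ T * r ^ 2 := by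
    rw [hT, Finset.sum_mul]
    refine norm_sum_le_of_le _ fun l _ => ?_
    rw [norm_mul, Complex.norm_real, Real.norm_eq_abs]
    calc |κ l| * ‖∑ m, M l m * κ m‖ ≤ r * ((∑ m, ‖M l m‖) * r) :=
          mul_le_mul (hκ l) (h1 l) (norm_nonneg _) hrpos.le
      _ = _ := by ring
  have h3 : ‖amplitude κ M i‖ ≤ 1 / r ^ 2 * (2 * (T * r) + r / r ^ 2 * (T * r ^ 2)) := by
    rw [amplitude, ← hq, ← hrq, norm_mul, norm_div, norm_neg, Complex.norm_I, Complex.norm_real,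
      Real.norm_of_nonneg (sq_nonneg r)]
    refine mul_le_mul_of_nonneg_left ?_ (by positivity)
    refine (norm_sub_le _ _).trans (add_le_add ?_ ?_)
    · rw [norm_mul, Complex.norm_ofNat]
      linarith
    · rw [norm_mul, norm_div, Complex.norm_real, Complex.norm_real, Real.norm_eq_abs,
        Real.norm_of_nonneg (sq_nonneg r)]
      gcongr
      exact hκ i
  calc r * ‖amplitude κ M i‖ ≤ r * (1 / r ^ 2 * (2 * (T * r) + r / r ^ 2 * (T * r ^ 2))) :=
        mul_le_mul_of_nonneg_left h3 hrpos.le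
    _ = 3 * T := by
        field_simp
        ring

/-- Nonzero wave vectors are bounded away from zero. -/
lemma UnitCell.exists_le_wave (C : UnitCell d) :
    ∃ c : ℝ, 0 < c ∧ ∀ k, √(∑ l, C.wave k l ^ 2) ≠ 0 → c ≤ √(∑ l, C.wave k l ^ 2) := by
  -- The phase at `Y_l` is `2π k_l` and is at most `B |κ|` in absolute value. Hence `|κ| < 1 / B`
  -- forces `2π |k_l| ≤ 1`, so the integer `k_l` is zero. The summand `1` keeps `B` positive in
  -- every dimension.
  set B : ℝ := 1 + ∑ l, ∑ j, |(C.Y l) j| with hB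
  have hB1 : 1 ≤ B := le_add_of_nonneg_right
    (Finset.sum_nonneg fun l _ => Finset.sum_nonneg fun j _ => abs_nonneg _)
  refine ⟨1 / B, by positivity, fun k hk => ?_⟩
  by_contra! hlt
  refine hk ?_
  have hκ : ∀ j, |C.wave k j| ≤ √(∑ l, C.wave k l ^ 2) := fun j =>
    Real.abs_le_sqrt (Finset.single_le_sum (f := fun l => C.wave k l ^ 2)
      (fun l _ => sq_nonneg _) (Finset.mem_univ j))
  have hkl : ∀ l, k l = 0 := by
    intro l
    have h1 : C.phase k (C.Y l) = 2 * Real.pi * k l := by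
      rw [C.phase_apply]
      simp [Finsupp.single_apply]
    have h2 : C.phase k (C.Y l) = ∑ j, (C.Y l) j * C.wave k j := by
      have hY : C.Y l = ∑ j, (C.Y l) j • EuclideanSpace.single j (1 : ℝ) := by
        ext i
        simp [Finset.sum_apply, Pi.single_apply]
      conv_lhs => rw [hY]
      simp only [map_sum, map_smul, C.phase_single, smul_eq_mul]
    have h3 : |C.phase k (C.Y l)| ≤ 1 := by
      rw [h2]
      calc |∑ j, (C.Y l) j * C.wave k j| ≤ ∑ j, |(C.Y l) j| * (1 / B) := by
            refine (Finset.abs_sum_le_sum_abs _ _).trans (Finset.sum_le_sum fun j _ => ?_)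
            rw [abs_mul]
            exact mul_le_mul_of_nonneg_left ((hκ j).trans hlt.le) (abs_nonneg _)
        _ = (∑ j, |(C.Y l) j|) * (1 / B) := by rw [Finset.sum_mul]
        _ ≤ B * (1 / B) := by
            refine mul_le_mul_of_nonneg_right ?_ (by positivity)
            have := Finset.single_le_sum (f := fun l => ∑ j, |(C.Y l) j|)
              (fun l _ => Finset.sum_nonneg fun j _ => abs_nonneg _) (Finset.mem_univ l)
            simp only at this
            linarith
        _ = 1 := by field_simp
    rw [h1, abs_mul, abs_of_pos Real.two_pi_pos] at h3
    by_contra hne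
    have h4 : (1 : ℝ) ≤ |(k l : ℝ)| := by
      exact_mod_cast Int.one_le_abs hne
    nlinarith [Real.pi_gt_three]
  have : ∀ j, C.wave k j = 0 := fun j => by simp [UnitCell.wave, hkl]
  simp [this]

/-- Riesz–Fischer for coefficients dominated by those of a tensor field. -/
lemma exists_coeff_eq {C : UnitCell d} (η : TensorField C) {a : (Fin d → ℤ) → ℂ} {K : ℝ}
    (h : ∀ k, ‖a k‖ ≤ K * ∑ l, ∑ m, ‖coeff k (comp C l m η)‖) :
    ∃ u : TorusL2 d, ∀ k, coeff k u = a k := by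
  have h1 : ∀ l m, Memℓp (fun k => ‖coeff k (comp C l m η)‖) 2 := by
    intro l m
    refine memℓp_norm_iff.2 ?_
    have := lp.memℓp (UnitAddTorus.mFourierBasis.repr (comp C l m η))
    convert! this using 2 with k
    rw [HilbertBasis.repr_apply_apply, UnitAddTorus.coe_mFourierBasis]
    rfl
  have h2 : Memℓp (fun k => K * ∑ l, ∑ m, ‖coeff k (comp C l m η)‖) 2 :=
    (Memℓp.finsetSum _ fun l _ => Memℓp.finsetSum _ fun m _ => h1 l m).const_mul K
  have h3 : Memℓp a 2 := h2.mono h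
  refine ⟨UnitAddTorus.mFourierBasis.repr.symm ⟨a, h3⟩, fun k => ?_⟩
  have := UnitAddTorus.mFourierBasis.repr_apply_apply
    (UnitAddTorus.mFourierBasis.repr.symm ⟨a, h3⟩) k
  rw [LinearIsometryEquiv.apply_symm_apply, UnitAddTorus.coe_mFourierBasis] at this
  exact this.symm

/-- The transported function only sees the box, but by invariance a null set there is null
everywhere. -/
lemma cellLp_injective (C : UnitCell d) : Function.Injective (cellLp C) := by
  refine (injective_iff_map_eq_zero _).2 fun f hf => Subtype.ext ?_
  obtain ⟨g, hfg, hg⟩ := exists_periodic_rep f.2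
  have hc : Countable C.lattice := inferInstance
  have h1 : ∀ᵐ t, f.1 (C.cellMap t) = 0 := by
    filter_upwards [coeFn_cellLp f, Lp.coeFn_zero ℂ 2 (volume : Measure (Torus d))] with t a b
    rw [hf, b] at a
    exact Complex.ofReal_eq_zero.1 a.symm
  have hms : MeasurableSet {x | f.1 x = 0} :=
    f.1.stronglyMeasurable.measurable (measurableSet_singleton 0)
  have h2 := (ae_map_iff C.measurable_cellMap.aemeasurable hms).2 h1
  rw [C.map_cellMap, Measure.ae_ennreal_smul_measure_iff
    (ENNReal.inv_ne_zero.2 C.volume_box_ne_top)] at h2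
  have h3 : ∀ᵐ x ∂(volume.restrict C.box), g x = 0 := by
    filter_upwards [h2, ae_restrict_of_ae hfg] with x a b
    rw [← b, a]
  have h0 : (volume : Measure (Space d)) {x | g x ≠ 0} = 0 := by
    refine (ZSpan.isAddFundamentalDomain C.Y volume).measure_zero_of_invariant _ (fun Y => ?_) ?_
    · ext x
      rw [Set.mem_vadd_set_iff_neg_vadd_mem, Set.mem_ofPred_eq, Set.mem_ofPred_eq, hg]
    · rw [← Measure.restrict_apply' (ZSpan.fundamentalDomain_measurableSet C.Y)]
      exact h3
  refine AEEqFun.ext ?_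
  have h4 : ∀ᵐ x, g x = 0 := h0
  filter_upwards [h4, hfg, AEEqFun.coeFn_zero (μ := (volume : Measure (Space d))) (β := ℝ)]
    with x a b c
  exact (b.trans a).trans c.symm

/-- Compatible strain fields are characterized by their Fourier coefficients. -/
lemma mem_E0_iff {C : UnitCell d} {L₀ : Stiffness d} (e : StrainSpace C L₀) :
    e ∈ E0 C L₀ ↔ ∀ k, IsCompatible (C.wave k) fun i j => coeff k (comp C i j e.field) := by
  refine ⟨fun he k => ?_, fun h => ?_⟩
  · obtain ⟨a, ha⟩ := exists_coeff_of_mem_E0 he k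
    exact isCompatible_of_exists ha
  · set M : (Fin d → ℤ) → Fin d → Fin d → ℂ := fun k i j => coeff k (comp C i j e.field) with hM
    obtain ⟨c, hc, hcw⟩ := C.exists_le_wave
    -- Square-summability of the displacement coefficients is where the lower bound on nonzero wave
    -- vectors is needed.
    have hw : ∀ i, ∃ u : TorusL2 d, ∀ k, coeff k u = amplitude (C.wave k) (M k) i := by
      intro i
      refine exists_coeff_eq e.field (K := 3 / c) fun k => ?_
      have hT0 : 0 ≤ ∑ l, ∑ m, ‖coeff k (comp C l m e.field)‖ :=
        Finset.sum_nonneg fun l _ => Finset.sum_nonneg fun m _ => norm_nonneg _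
      have h1 := norm_amplitude_mul_le (C.wave k) (M k) i
      -- At the zero wave vector, division by zero makes the amplitude zero, so the displacement is
      -- chosen mean-free.
      by_cases h0 : √(∑ l, C.wave k l ^ 2) = 0
      · have hq : ∑ l, C.wave k l ^ 2 = 0 := (Real.sqrt_eq_zero
          (Finset.sum_nonneg fun l _ => sq_nonneg _)).1 h0
        rw [amplitude, hq]
        simp only [Complex.ofReal_zero, div_zero, zero_mul, norm_zero]
        positivity
      · have h2 : c * ‖amplitude (C.wave k) (M k) i‖ ≤ 3 * ∑ l, ∑ m, ‖M k l m‖ :=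
          (mul_le_mul_of_nonneg_right (hcw k h0) (norm_nonneg _)).trans h1
        rw [div_mul_eq_mul_div, le_div_iff₀ hc, mul_comm]
        exact h2
    -- For the gradient the factor `κ_j` absorbs the `1 / |κ|` of the amplitude, so no lower bound
    -- enters.
    have hG : ∀ i j, ∃ U : TorusL2 d, ∀ k,
        coeff k U = Complex.I * (C.wave k j : ℝ) * amplitude (C.wave k) (M k) i := by
      intro i j
      refine exists_coeff_eq e.field (K := 3) fun k => ?_
      rw [norm_mul, norm_mul, Complex.norm_I, one_mul, Complex.norm_real, Real.norm_eq_abs]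
      refine (mul_le_mul_of_nonneg_right ?_ (norm_nonneg _)).trans
        (norm_amplitude_mul_le (C.wave k) (M k) i)
      exact Real.abs_le_sqrt (Finset.single_le_sum (f := fun l => C.wave k l ^ 2)
        (fun l _ => sq_nonneg _) (Finset.mem_univ j))
    choose u hu using hw
    choose U hU using hG
    refine ⟨fun i => (periodicRe C (u i)).1, fun i j => (periodicRe C (U i j)).1,
      ⟨fun i => (periodicRe C (u i)).2, fun i j => (periodicRe C (U i j)).2,
        fun i j => isWeakPartial_periodicRe C fun k => by rw [hU, hu]⟩, fun i j => ?_⟩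
    have hsum : comp C i j e.field = (1 / 2 : ℝ) • (U i j + U j i) := by
      refine eq_of_coeff fun k => ?_
      rw [coeff_real_smul, map_add, hU, hU]
      refine (h k i j).trans ?_
      push_cast
      ring
    -- The functions `U i j` have not been shown to be real. Their symmetrized sum is, since it
    -- equals the strain component, so real parts are compared for the sum.
    have hinj : (⟨e.field.1 i j, e.field.2.2 i j⟩ : L2per C) =
        (1 / 2 : ℝ) • (periodicRe C (U i j) + periodicRe C (U j i)) := by
      refine cellLp_injective C ?_
      rw [map_smul, map_add]
      refine Lp.ext ?_
      have hs : cellLp C ⟨e.field.1 i j, e.field.2.2 i j⟩ = (1 / 2 : ℝ) • (U i j + U j i) := hsum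
      have hre := coeFn_cellLp (⟨e.field.1 i j, e.field.2.2 i j⟩ : L2per C)
      rw [hs] at hre
      rw [hs]
      filter_upwards [hre, Lp.coeFn_smul (1 / 2 : ℝ) (U i j + U j i), Lp.coeFn_add (U i j) (U j i),
        Lp.coeFn_smul (1 / 2 : ℝ) (cellLp C (periodicRe C (U i j)) +
          cellLp C (periodicRe C (U j i))),
        Lp.coeFn_add (cellLp C (periodicRe C (U i j))) (cellLp C (periodicRe C (U j i))),
        coeFn_cellLp (periodicRe C (U i j)), coeFn_cellLp (periodicRe C (U j i)),
        coeFn_periodicRe C (U i j), coeFn_periodicRe C (U j i)] with t a1 a2 a3 a4 a5 a6 a7 a8 a9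
      rw [a4, Pi.smul_apply, a5, Pi.add_apply, a6, a7, a8, a9]
      rw [a1] at a2 ⊢
      rw [Pi.smul_apply, a3, Pi.add_apply] at a2
      have h1 := congrArg Complex.re a2
      rw [Complex.ofReal_re, Complex.smul_re, Complex.add_re] at h1
      rw [h1, Complex.real_smul]
      push_cast
      simp
    exact congrArg Subtype.val hinj

/-! ### Completeness -/

/-- The energy density is a continuous quadratic form; its extrema over the compact unit sphere of
symmetric tensors give the constants, and the minimum is positive by `pos_def`. Homogeneity does the
rest. -/
lemma Stiffness.exists_bounds (L₀ : Stiffness d) : ∃ α β : ℝ, 0 < α ∧ 0 < β ∧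
    ∀ a : Fin d → Fin d → ℝ, (∀ i j, a i j = a j i) →
      α * ∑ i, ∑ j, a i j * a i j ≤ ∑ i, ∑ j, (∑ k, ∑ l, L₀.c i j k l * a k l) * a i j ∧
      ∑ i, ∑ j, (∑ k, ∑ l, L₀.c i j k l * a k l) * a i j ≤ β * ∑ i, ∑ j, a i j * a i j := by
  set Q : (Fin d → Fin d → ℝ) → ℝ :=
    fun a => ∑ i, ∑ j, (∑ k, ∑ l, L₀.c i j k l * a k l) * a i j with hQ
  set n : (Fin d → Fin d → ℝ) → ℝ := fun a => ∑ i, ∑ j, a i j * a i j with hn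
  have hQc : Continuous Q := by fun_prop
  have hnc : Continuous n := by fun_prop
  have hnn : ∀ a, 0 ≤ n a := fun a =>
    Finset.sum_nonneg fun i _ => Finset.sum_nonneg fun j _ => mul_self_nonneg _
  have hentry : ∀ a i j, a i j * a i j ≤ n a := fun a i j =>
    (Finset.single_le_sum (f := fun j => a i j * a i j) (fun j _ => mul_self_nonneg _)
      (Finset.mem_univ j)).trans
    (Finset.single_le_sum (f := fun i => ∑ j, a i j * a i j)
      (fun i _ => Finset.sum_nonneg fun j _ => mul_self_nonneg _) (Finset.mem_univ i))
  set K : Set (Fin d → Fin d → ℝ) := {a | (∀ i j, a i j = a j i) ∧ n a = 1} with hK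
  have hKc : IsCompact K := by
    refine Metric.isCompact_of_isClosed_isBounded ?_ ?_
    · have h1 : IsClosed {a : Fin d → Fin d → ℝ | ∀ i j, a i j = a j i} := by
        simp only [Set.ofPred_forall]
        exact isClosed_iInter fun i => isClosed_iInter fun j =>
          isClosed_eq (by fun_prop) (by fun_prop)
      exact h1.inter (isClosed_eq hnc continuous_const)
    · refine (Metric.isBounded_closedBall (x := (0 : Fin d → Fin d → ℝ)) (r := 1)).subset ?_
      intro a ha
      rw [mem_closedBall_zero_iff]
      refine (pi_norm_le_iff_of_nonneg zero_le_one).2 fun i =>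
        (pi_norm_le_iff_of_nonneg zero_le_one).2 fun j => ?_
      have := hentry a i j
      rw [ha.2] at this
      rw [Real.norm_eq_abs]
      exact abs_le_one_iff_mul_self_le_one.2 this
  have hscaleQ : ∀ (r : ℝ) a, Q (r • a) = r * r * Q a := by
    intro r a
    simp only [hQ, Pi.smul_apply, smul_eq_mul, Finset.mul_sum, Finset.sum_mul]
    refine Finset.sum_congr rfl fun i _ => Finset.sum_congr rfl fun j _ =>
      Finset.sum_congr rfl fun k _ => Finset.sum_congr rfl fun l _ => by ring
  have hscalen : ∀ (r : ℝ) a, n (r • a) = r * r * n a := by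
    intro r a
    simp only [hn, Pi.smul_apply, smul_eq_mul, Finset.mul_sum]
    refine Finset.sum_congr rfl fun i _ => Finset.sum_congr rfl fun j _ => by ring
  have hunit : ∀ a : Fin d → Fin d → ℝ, (∀ i j, a i j = a j i) → a ≠ 0 →
      0 < n a ∧ (√(n a))⁻¹ • a ∈ K ∧ Q a = n a * Q ((√(n a))⁻¹ • a) := by
    intro a hs ha
    have hpos : 0 < n a := by
      refine (hnn a).lt_of_ne' fun h0 => ha ?_
      ext i j
      have := hentry a i j
      rw [h0] at this
      exact mul_self_eq_zero.1 (this.antisymm (mul_self_nonneg _))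
    have hr : (√(n a))⁻¹ * (√(n a))⁻¹ = (n a)⁻¹ := by
      rw [← mul_inv, Real.mul_self_sqrt hpos.le]
    refine ⟨hpos, ⟨fun i j => ?_, ?_⟩, ?_⟩
    · simp only [Pi.smul_apply, hs i j]
    · rw [hscalen, hr, inv_mul_cancel₀ hpos.ne']
    · rw [hscaleQ, hr, mul_inv_cancel_left₀ hpos.ne']
  -- The sphere is empty only for `d = 0`, when any constants will do.
  rcases K.eq_empty_or_nonempty with hE | hne
  · refine ⟨1, 1, one_pos, one_pos, fun a hs => ?_⟩
    by_cases ha : a = 0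
    · simp [ha]
    · have := (hunit a hs ha).2.1
      simp [hE] at this
  · obtain ⟨x, hx, hxm⟩ := hKc.exists_isMinOn hne hQc.continuousOn
    obtain ⟨y, hy, hym⟩ := hKc.exists_isMaxOn hne hQc.continuousOn
    have hx0 : x ≠ 0 := by
      rintro rfl
      have := hx.2
      simp [hn] at this
    have hα : 0 < Q x := L₀.pos_def x hx.1 hx0
    refine ⟨Q x, Q y, hα, hα.trans_le (hym hx), fun a hs => ?_⟩
    by_cases ha : a = 0
    · simp [ha]
    · obtain ⟨h1, h2, h3⟩ := hunit a hs ha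
      change Q x * n a ≤ Q a ∧ Q a ≤ Q y * n a
      rw [h3, mul_comm (Q x), mul_comm (Q y)]
      exact ⟨mul_le_mul_of_nonneg_left (hxm h2) h1.le, mul_le_mul_of_nonneg_left (hym h2) h1.le⟩

lemma pairing_mono {C : UnitCell d} {τ η σ ζ : TensorField C} {r : ℝ}
    (h : ∀ᵐ x, ∑ i, ∑ j, τ.1 i j x * η.1 i j x ≤ r * ∑ i, ∑ j, σ.1 i j x * ζ.1 i j x) :
    pairing τ η ≤ r * pairing σ ζ := by
  simp only [pairing, setAverage_eq, smul_eq_mul]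
  rw [mul_left_comm, ← integral_const_mul r]
  exact mul_le_mul_of_nonneg_left (integral_mono_ae (integrable_cell τ η)
    ((integrable_cell σ ζ).const_mul r) (ae_restrict_of_ae h)) (inv_nonneg.2 measureReal_nonneg)

lemma pairing_self_eq {C : UnitCell d} (η : TensorField C) :
    pairing η η = ∑ i, ∑ j, ‖comp C i j η‖ ^ 2 := by
  rw [pairing_eq_inner]
  refine Finset.sum_congr rfl fun i _ => Finset.sum_congr rfl fun j _ => ?_
  exact inner_self_eq_norm_sq (𝕜 := ℂ) (comp C i j η)

lemma StrainSpace.inner_eq {C : UnitCell d} {L₀ : Stiffness d} (η ζ : StrainSpace C L₀) :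
    inner ℝ η ζ = pairing (L₀.act η.field) ζ.field := rfl

lemma StrainSpace.norm_sq_eq {C : UnitCell d} {L₀ : Stiffness d} (η : StrainSpace C L₀) :
    ‖η‖ ^ 2 = pairing (L₀.act η.field) η.field := by
  rw [← StrainSpace.inner_eq, real_inner_self_eq_norm_sq]

/-- The energetic norm is equivalent to the `L²` norm. -/
lemma StrainSpace.exists_norm_bounds (C : UnitCell d) (L₀ : Stiffness d) : ∃ α β : ℝ,
    0 < α ∧ 0 < β ∧ ∀ η : StrainSpace C L₀,
      (∑ i, ∑ j, ‖comp C i j η.field‖ ^ 2) ≤ α * ‖η‖ ^ 2 ∧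
      ‖η‖ ^ 2 ≤ β * ∑ i, ∑ j, ‖comp C i j η.field‖ ^ 2 := by
  obtain ⟨α, β, hα, hβ, h⟩ := L₀.exists_bounds
  refine ⟨α⁻¹, β, inv_pos.2 hα, hβ, fun η => ?_⟩
  rw [StrainSpace.norm_sq_eq, ← pairing_self_eq]
  constructor
  · refine pairing_mono ?_
    filter_upwards [act_apply_ae L₀ η.field, symm_ae η.field] with x h1 h2
    simp only [h1]
    rw [inv_mul_eq_div, le_div_iff₀' hα]
    exact (h (fun i j => η.field.1 i j x) h2).1
  · refine pairing_mono ?_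
    filter_upwards [act_apply_ae L₀ η.field, symm_ae η.field] with x h1 h2
    simp only [h1]
    exact (h (fun i j => η.field.1 i j x) h2).2

/-- A component of a strain field, as a continuous linear map into `L²` of the torus. -/
def compL (C : UnitCell d) (L₀ : Stiffness d) (i j : Fin d) : StrainSpace C L₀ →L[ℝ] TorusL2 d :=
  LinearMap.mkContinuousOfExistsBound
    { toFun := fun η => comp C i j η.field
      map_add' := fun η ζ => (comp C i j).map_add η.field ζ.field
      map_smul' := fun r η => (comp C i j).map_smul r η.field } <| by
    obtain ⟨α, β, hα, -, h⟩ := StrainSpace.exists_norm_bounds C L₀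
    refine ⟨√α, fun η => ?_⟩
    have h1 : ‖comp C i j η.field‖ ^ 2 ≤ α * ‖η‖ ^ 2 :=
      ((Finset.single_le_sum (f := fun j => ‖comp C i j η.field‖ ^ 2) (fun j _ => sq_nonneg _)
        (Finset.mem_univ j)).trans
      (Finset.single_le_sum (f := fun i => ∑ j, ‖comp C i j η.field‖ ^ 2)
        (fun i _ => Finset.sum_nonneg fun j _ => sq_nonneg _) (Finset.mem_univ i))).trans (h η).1
    refine abs_le_of_sq_le_sq' ?_ (by positivity) |>.2
    rw [mul_pow, Real.sq_sqrt hα.le]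
    exact h1

lemma compL_apply {C : UnitCell d} {L₀ : Stiffness d} (i j : Fin d) (η : StrainSpace C L₀) :
    compL C L₀ i j η = comp C i j η.field := rfl

/-- The components of a Cauchy sequence converge in complex `L²` of the torus. The real parts of the
limits form a symmetric field, no farther from the sequence than the limits themselves, and the norm
equivalence turns this into energetic convergence. -/
instance (C : UnitCell d) (L₀ : Stiffness d) : CompleteSpace (StrainSpace C L₀) := by
  refine Metric.complete_of_cauchySeq_tendsto fun η hη => ?_
  obtain ⟨α, β, -, hβ, h⟩ := StrainSpace.exists_norm_bounds C L₀
  have hlim : ∀ i j, ∃ u, Tendsto (fun n => compL C L₀ i j (η n)) atTop (𝓝 u) := fun i j =>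
    cauchySeq_tendsto_of_complete ((compL C L₀ i j).uniformContinuous.comp_cauchySeq hη)
  choose u hu using hlim
  have hsymm : ∀ i j, u i j = u j i := fun i j => by
    refine tendsto_nhds_unique (hu i j) ?_
    simp only [compL_apply]
    simp only [comp_symm i j]
    exact hu j i
  let f : StrainSpace C L₀ := (⟨fun i j => (periodicRe C (u i j)).1,
    fun i j => congrArg (fun v => (periodicRe C v).1) (hsymm i j),
    fun i j => (periodicRe C (u i j)).2⟩ : TensorField C)
  refine ⟨f, tendsto_iff_norm_sub_tendsto_zero.2 ?_⟩
  have hcomp : ∀ i j, Tendsto (fun n => ‖compL C L₀ i j (η n - f)‖ ^ 2) atTop (𝓝 0) := by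
    intro i j
    have h1 := (tendsto_iff_norm_sub_tendsto_zero.1 (hu i j)).pow 2
    rw [zero_pow two_ne_zero] at h1
    refine squeeze_zero (fun n => sq_nonneg _) (fun n => ?_) h1
    refine pow_le_pow_left₀ (norm_nonneg _) ?_ 2
    rw [map_sub, norm_sub_rev, norm_sub_rev (compL C L₀ i j (η n))]
    exact norm_cellLp_periodicRe_sub_le C (u i j) ⟨(η n).field.1 i j, (η n).field.2.2 i j⟩
  have hsum : Tendsto (fun n => β * ∑ i, ∑ j, ‖compL C L₀ i j (η n - f)‖ ^ 2) atTop (𝓝 0) := by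
    have := (tendsto_finsetSum Finset.univ fun i _ =>
      tendsto_finsetSum Finset.univ fun j _ => hcomp i j).const_mul β
    simpa using this
  have hsq : Tendsto (fun n => ‖η n - f‖ ^ 2) atTop (𝓝 0) :=
    squeeze_zero (fun n => sq_nonneg _) (fun n => (h (η n - f)).2) hsum
  have := hsq.sqrt
  simpa [Real.sqrt_sq] using this

/-- Because the amplitude is an explicit expression in the coefficients rather than an existentially
quantified vector, compatibility is a family of equations between continuous functions. -/
lemma isClosed_E0 (C : UnitCell d) (L₀ : Stiffness d) :
    IsClosed (E0 C L₀ : Set (StrainSpace C L₀)) := by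
  have hset : (E0 C L₀ : Set (StrainSpace C L₀)) =
      ⋂ k, ⋂ i, ⋂ j, {e | coeff k (compL C L₀ i j e) = Complex.I / 2 *
        ((C.wave k j : ℂ) * amplitude (C.wave k) (fun i j => coeff k (compL C L₀ i j e)) i +
        (C.wave k i : ℂ) * amplitude (C.wave k) (fun i j => coeff k (compL C L₀ i j e)) j)} := by
    ext e
    simp only [SetLike.mem_coe, mem_E0_iff, Set.mem_iInter]
    rfl
  rw [hset]
  refine isClosed_iInter fun k => isClosed_iInter fun i => isClosed_iInter fun j => ?_
  have hc : ∀ i j, Continuous fun e => coeff k (compL C L₀ i j e) := fun i j =>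
    (coeff k).continuous.comp (compL C L₀ i j).continuous
  have ha : ∀ i, Continuous fun e =>
      amplitude (C.wave k) (fun i j => coeff k (compL C L₀ i j e)) i := by
    intro i
    simp only [amplitude]
    fun_prop
  exact isClosed_eq (hc i j) (continuous_const.mul
    ((continuous_const.mul (ha i)).add (continuous_const.mul (ha j))))

instance (C : UnitCell d) (L₀ : Stiffness d) : CompleteSpace (E0 C L₀) :=
  (isClosed_E0 C L₀).completeSpace_coe

/-! ### The Green's operator -/

/-- The work of a stress field, as a functional on compatible strain fields. -/
def work {C : UnitCell d} (L₀ : Stiffness d) (τ : StressSpace C) : E0 C L₀ →L[ℝ] ℝ :=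
  (∑ i, ∑ j, Complex.reCLM ∘L ((innerSL ℂ (comp C i j τ)).restrictScalars ℝ) ∘L
    compL C L₀ i j) ∘L (E0 C L₀).subtypeL

lemma work_apply {C : UnitCell d} {L₀ : Stiffness d} (τ : StressSpace C) (e : E0 C L₀) :
    work L₀ τ e = pairing τ e.1.field := by
  rw [pairing_eq_inner]
  simp only [work, ContinuousLinearMap.comp_apply, sum_apply]
  rfl

lemma pairing_comm {C : UnitCell d} (τ η : TensorField C) : pairing τ η = pairing η τ := by
  simp only [pairing, mul_comm]

/-- This is the weak form of the problem: membership in `S` means doing no work in any compatible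
strain, and the work of `L₀ e` is the energetic scalar product with `e`. -/
lemma solvesEshelby_iff {C : UnitCell d} {L₀ : Stiffness d} (τ : StressSpace C) (e : E0 C L₀) :
    SolvesEshelby τ e ↔ ∀ h : E0 C L₀, inner ℝ e h = pairing τ h.1.field := by
  have hsub : ∀ h : E0 C L₀, pairing (L₀.act e.1.field - τ) h.1.field =
      inner ℝ e h - pairing τ h.1.field := by
    intro h
    have : L₀.act e.1.field - τ = L₀.act e.1.field + (-1 : ℝ) • τ := by module
    rw [this, pairing_add_left, pairing_smul_left, Submodule.coe_inner, StrainSpace.inner_eq]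
    ring
  constructor
  · intro hs h
    have := pairing_eq_zero_of_mem hs h.2
    rw [hsub] at this
    exact sub_eq_zero.1 this
  · intro hs
    refine mem_S_of_pairing_eq_zero L₀ fun h hh => ?_
    exact (hsub ⟨h, hh⟩).trans (sub_eq_zero.2 (hs ⟨h, hh⟩))

/-- The solution is the Riesz representative of the work functional of `τ` on the Hilbert space
`E0`. -/
lemma exists_solvesEshelby {C : UnitCell d} (L₀ : Stiffness d) (τ : StressSpace C) :
    ∃ e : E0 C L₀, SolvesEshelby τ e := by
  refine ⟨(InnerProductSpace.toDual ℝ (E0 C L₀)).symm (work L₀ τ), ?_⟩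
  rw [solvesEshelby_iff]
  intro h
  rw [InnerProductSpace.toDual_symm_apply, work_apply]

lemma inner_green {C : UnitCell d} (L₀ : Stiffness d) (τ : StressSpace C) (h : E0 C L₀) :
    inner ℝ (green L₀ τ) h = pairing τ h.1.field := by
  refine (solvesEshelby_iff τ _).1 ?_ h
  rw [green, dif_pos (exists_solvesEshelby L₀ τ)]
  exact (exists_solvesEshelby L₀ τ).choose_spec

lemma solvesEshelby_iff_eq_green {C : UnitCell d} {L₀ : Stiffness d} (τ : StressSpace C)
    (e : E0 C L₀) : SolvesEshelby τ e ↔ e = green L₀ τ := by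
  rw [solvesEshelby_iff]
  refine ⟨fun h => ext_inner_right ℝ fun v => ?_, fun h v => ?_⟩
  · rw [h, inner_green]
  · rw [h, inner_green]

lemma green_add_smul {C : UnitCell d} (L₀ : Stiffness d) (τ σ : StressSpace C) (t : ℝ) :
    green L₀ (τ + t • σ) = green L₀ τ + t • green L₀ σ := by
  refine ext_inner_right ℝ fun v => ?_
  rw [inner_green, pairing_add_left, pairing_smul_left, inner_add_left, real_inner_smul_left,
    inner_green, inner_green]

/-! ### The gradients -/

lemma aeEqFun_mul_add_smul (a f g : Space d →ₘ[volume] ℝ) (t : ℝ) :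
    a * (f + t • g) = a * f + t • (a * g) := by
  refine AEEqFun.induction_on₃ a f g fun a ha f hf g hg => ?_
  rw [AEEqFun.smul_mk, AEEqFun.mk_add_mk, AEEqFun.mk_mul_mk, AEEqFun.mk_mul_mk, AEEqFun.mk_mul_mk,
    AEEqFun.smul_mk, AEEqFun.mk_add_mk, AEEqFun.mk_eq_mk]
  refine Eventually.of_forall fun x => ?_
  simp only [Pi.mul_apply, Pi.add_apply, Pi.smul_apply, smul_eq_mul]
  ring

lemma ElasticityField.act_add_smul {C : UnitCell d} (L : ElasticityField C) (η ζ : TensorField C)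
    (t : ℝ) : L.act (η + t • ζ) = L.act η + t • L.act ζ := by
  refine Subtype.ext (funext fun i => funext fun j => ?_)
  simp only [ElasticityField.act, Submodule.coe_add, Submodule.coe_smul, Pi.add_apply,
    Pi.smul_apply, aeEqFun_mul_add_smul, Finset.sum_add_distrib, Finset.smul_sum]

lemma ElasticityField.act_apply_ae {C : UnitCell d} (L : ElasticityField C) (η : TensorField C) :
    ∀ᵐ x, ∀ i j, (L.act η).1 i j x = ∑ k, ∑ l, L.c i j k l x * η.1 k l x := by
  refine ae_all_iff.2 fun i => ae_all_iff.2 fun j => ?_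
  set T : Fin d → Fin d → (Space d →ₘ[volume] ℝ) := fun k l =>
    AEEqFun.mk (L.c i j k l) (L.bounded i j k l).aestronglyMeasurable * η.1 k l with hT
  have h1 : ∀ᵐ x, ∀ k l, T k l x = L.c i j k l x * η.1 k l x := by
    refine ae_all_iff.2 fun k => ae_all_iff.2 fun l => ?_
    filter_upwards [AEEqFun.coeFn_mul (AEEqFun.mk (L.c i j k l)
        (L.bounded i j k l).aestronglyMeasurable) (η.1 k l),
      AEEqFun.coeFn_mk (L.c i j k l) (L.bounded i j k l).aestronglyMeasurable] with x a b
    rw [hT]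
    refine a.trans ?_
    rw [Pi.mul_apply, b]
  have h2 : ∀ᵐ x, ∀ k, (∑ l, T k l : Space d →ₘ[volume] ℝ) x = ∑ l, T k l x := by
    refine ae_all_iff.2 fun k => ?_
    filter_upwards [AEEqFun.coeFn_finsetSum Finset.univ (fun l => T k l)] with x hx
    simpa using hx
  have h3 : ∀ᵐ x, (∑ k, ∑ l, T k l : Space d →ₘ[volume] ℝ) x
      = ∑ k, (∑ l, T k l : Space d →ₘ[volume] ℝ) x := by
    filter_upwards [AEEqFun.coeFn_finsetSum Finset.univ (fun k => ∑ l, T k l)] with x hx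
    simpa using hx
  filter_upwards [h1, h2, h3] with x a b c
  exact c.trans (Finset.sum_congr rfl fun k _ => (b k).trans
    (Finset.sum_congr rfl fun l _ => a k l))

lemma ElasticityField.pairing_act_comm {C : UnitCell d} (L : ElasticityField C)
    (η ζ : TensorField C) : pairing (L.act η) ζ = pairing (L.act ζ) η := by
  simp only [pairing, setAverage_eq]
  congr 1
  refine integral_congr_ae (ae_restrict_of_ae ?_)
  have hmaj : ∀ᵐ x, ∀ i j k l, L.c i j k l x = L.c k l i j x :=
    ae_all_iff.2 fun i => ae_all_iff.2 fun j => ae_all_iff.2 fun k => ae_all_iff.2 fun l =>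
      L.major i j k l
  filter_upwards [L.act_apply_ae η, L.act_apply_ae ζ, hmaj] with x h1 h2 h3
  -- With the indices grouped in pairs, major symmetry is the symmetry of a matrix, and exchanging
  -- the two sums suffices.
  have key : ∀ a b : Fin d → Fin d → ℝ,
      ∑ i, ∑ j, (∑ k, ∑ l, L.c i j k l x * a k l) * b i j
        = ∑ p : Fin d × Fin d, ∑ q : Fin d × Fin d,
            L.c p.1 p.2 q.1 q.2 x * a q.1 q.2 * b p.1 p.2 := by
    intro a b
    simp only [Fintype.sum_prod_type, Finset.sum_mul]
  simp only [h1, h2]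
  rw [key (fun k l => η.1 k l x) (fun k l => ζ.1 k l x),
    key (fun k l => ζ.1 k l x) (fun k l => η.1 k l x), Finset.sum_comm]
  refine Finset.sum_congr rfl fun p _ => Finset.sum_congr rfl fun q _ => ?_
  rw [h3 q.1 q.2 p.1 p.2]
  ring

lemma pairing_add_smul_right {C : UnitCell d} (τ η ζ : TensorField C) (t : ℝ) :
    pairing τ (η + t • ζ) = pairing τ η + t * pairing τ ζ := by
  rw [pairing_comm, pairing_add_left, pairing_smul_left, pairing_comm η, pairing_comm ζ]

lemma stress_add_smul {C : UnitCell d} {L₀ : Stiffness d} (L : ElasticityField C)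
    (εbar : StrainSpace C L₀) (e h : E0 C L₀) (t : ℝ) :
    stress L εbar (e + t • h) = stress L εbar e + t • L.act h.1.field := by
  rw [stress, stress, ← L.act_add_smul]
  have : εbar + ((e + t • h : E0 C L₀) : StrainSpace C L₀) = (εbar + e.1) + t • h.1 := by
    rw [Submodule.coe_add, Submodule.coe_smul, add_assoc]
  rw [this]
  rfl

lemma IsGradientAt.unique {C : UnitCell d} {L₀ : Stiffness d} {F : E0 C L₀ → ℝ} {e g g' : E0 C L₀}
    (hg : IsGradientAt F e g) (hg' : IsGradientAt F e g') : g = g' :=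
  ext_inner_right ℝ fun v => tendsto_nhds_unique (hg v) (hg' v)

/-- Gradients of functionals that are quadratic along lines. -/
lemma isGradientAt_of_quadratic {C : UnitCell d} {L₀ : Stiffness d} {F : E0 C L₀ → ℝ}
    {e g : E0 C L₀} (q : E0 C L₀ → ℝ)
    (h : ∀ (v : E0 C L₀) (t : ℝ), F (e + t • v) = F e + t * inner ℝ g v + t ^ 2 * q v) :
    IsGradientAt F e g := by
  intro v
  have h1 : Tendsto (fun t : ℝ => inner ℝ g v + t * q v) (𝓝[≠] 0) (𝓝 (inner ℝ g v)) := by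
    have : Tendsto (fun t : ℝ => inner ℝ g v + t * q v) (𝓝 0) (𝓝 (inner ℝ g v + 0 * q v)) :=
      (by fun_prop : Continuous fun t : ℝ => inner ℝ g v + t * q v).tendsto 0
    rw [zero_mul, add_zero] at this
    exact this.mono_left nhdsWithin_le_nhds
  refine h1.congr' ?_
  filter_upwards [self_mem_nhdsWithin] with t ht
  have ht' : t ≠ 0 := ht
  rw [h]
  field_simp
  ring

/-- The two cross terms agree by the major symmetry of `L`, so the linear part in direction `v` is
the work of the stress `L (ε̄ + e)` in `v`, which `inner_green` represents by the Green's operator.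
-/
lemma isGradientAt_J {C : UnitCell d} {L₀ : Stiffness d} (L : ElasticityField C)
    (εbar : StrainSpace C L₀) (e : E0 C L₀) :
    IsGradientAt (J L εbar) e (green L₀ (stress L εbar e)) := by
  refine isGradientAt_of_quadratic (fun v => 1 / 2 * pairing (L.act v.1.field) v.1.field)
    fun v t => ?_
  have hfield : (εbar + ((e + t • v : E0 C L₀) : StrainSpace C L₀)).field =
      (εbar + e.1).field + t • v.1.field := by
    rw [Submodule.coe_add, Submodule.coe_smul, ← add_assoc]
    rfl
  have hsymm : pairing (L.act v.1.field) (εbar + e.1).field =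
      pairing (stress L εbar e) v.1.field := L.pairing_act_comm _ _
  rw [J, J, stress_add_smul, hfield, pairing_add_smul_right, pairing_add_left, pairing_add_left,
    pairing_smul_left, pairing_smul_left, inner_green, hsymm]
  ring

lemma grad_J {C : UnitCell d} {L₀ : Stiffness d} (L : ElasticityField C)
    (εbar : StrainSpace C L₀) (e : E0 C L₀) :
    grad (J L εbar) e = green L₀ (stress L εbar e) := by
  have h : ∃ g, IsGradientAt (J L εbar) e g := ⟨_, isGradientAt_J L εbar e⟩
  rw [grad, dif_pos h]
  exact h.choose_spec.unique (isGradientAt_J L εbar e)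

lemma N_eq {C : UnitCell d} {L₀ : Stiffness d} (L : ElasticityField C)
    (εbar : StrainSpace C L₀) (e : E0 C L₀) :
    N L εbar e = 1 / 2 * ‖green L₀ (stress L εbar e)‖ ^ 2 := by
  rw [N, grad_J]

/-- With `g = Γ₀ L (ε̄ + e)`, the linear part is `(g, Γ₀ L v) = ⟨L v : g⟩ = ⟨L g : v⟩ = (Γ₀ L g,
v)`, by `inner_green`, major symmetry and `inner_green` again. -/
lemma isGradientAt_N {C : UnitCell d} {L₀ : Stiffness d} (L : ElasticityField C)
    (εbar : StrainSpace C L₀) (e : E0 C L₀) :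
    IsGradientAt (N L εbar) e
      (green L₀ (L.act (green L₀ (stress L εbar e) : StrainSpace C L₀).field)) := by
  refine isGradientAt_of_quadratic (fun v => 1 / 2 * ‖green L₀ (L.act v.1.field)‖ ^ 2)
    fun v t => ?_
  have hinner : inner ℝ (green L₀ (stress L εbar e)) (green L₀ (L.act v.1.field)) =
      pairing (L.act (green L₀ (stress L εbar e) : StrainSpace C L₀).field) v.1.field := by
    rw [real_inner_comm, inner_green, L.pairing_act_comm]
  rw [N_eq, N_eq, stress_add_smul, green_add_smul, norm_add_sq_real, real_inner_smul_right, hinner,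
    norm_smul, inner_green, mul_pow, Real.norm_eq_abs, sq_abs]
  ring

end Homogenization

end

open Homogenization in
theorem proposition3p1 {d : ℕ} (C : UnitCell d) (L₀ : Stiffness d) (L : ElasticityField C)
    (εbar : StrainSpace C L₀) (hε : εbar ∈ Ue C L₀) :
    -- well-posedness: `Γ₀ τ` is the unique solution of the Eshelby problem with datum `τ`
    (∀ (τ : StressSpace C) (e : E0 C L₀), SolvesEshelby τ e ↔ e = green L₀ τ) ∧
    ∀ e : E0 C L₀,
      -- the gradient of the energy is `Γ₀ L (ε̄ + e*)`
      (∀ g : E0 C L₀, IsGradientAt (J L εbar) e g ↔ g = green L₀ (stress L εbar e)) ∧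
      -- `N(e*) = ½ ‖∇J(e*)‖² = ½ ‖Γ₀ L (ε̄ + e*)‖²`
      N L εbar e = 1 / 2 * ‖green L₀ (stress L εbar e)‖ ^ 2 ∧
      -- the gradient of `N` is `Γ₀ L Γ₀ L (ε̄ + e*)`
      (∀ g : E0 C L₀, IsGradientAt (N L εbar) e g ↔
        g = green L₀ (L.act (green L₀ (stress L εbar e) : StrainSpace C L₀).field)) := by
  exact ⟨solvesEshelby_iff_eq_green, fun e => ⟨fun g =>
    ⟨fun hg => hg.unique (isGradientAt_J L εbar e), fun hg => hg ▸ isGradientAt_J L εbar e⟩,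
    N_eq L εbar e, fun g =>
    ⟨fun hg => hg.unique (isGradientAt_N L εbar e), fun hg => hg ▸ isGradientAt_N L εbar e⟩⟩⟩
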